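/- The Wiener index of a connected graph $G$ is $W(G)=\frac12\sum_{u}\sum_{v} d(u,v)$, where $u,v$ run over the vertices of $G$. A graph is unicyclic if it is connected and contains exactly one cycle. Let $\mathcal{U}_{n,r}$ be the set of (finite, simple) unicyclic graphs with $n$ vertices, exactly $r$ of which have even degree. For rooted trees $T_1,\dots,T_g$ with $g\ge 3$, let $H(T_1,\dots,T_g)$ be the graph obtained from a cycle $u_1u_2\cdots u_gu_1$ by identifying $u_i$ with the root of a copy of $T_i$, for each $i$ (the copies being disjoint). Let $SB(1;b)$ be the star with $b$ edges rooted at its center, and let $K_1$, $K_2$ be the complete graphs on one and two vertices ($K_2$ is rooted at either vertex). For $b\ge 1$ and $t\ge 1$, $SaB(t;b)$ denotes any tree consisting of $b$ paths of positive length (branches) that start at a common vertex, the root, and are otherwise disjoint, such that each branch has length $t$ or $t-1$ and at least one has length $t$; for $b=0$ put $t=0$ and $SaB(0;0)=K_1$. **Theorem.** Let $r\ge 0$, and let $G\in\mathcal{U}_{n,r}$ be such that $W(G)$ is minimum among all graphs in $\mathcal{U}_{n,r}$. (1) If $r\le 2$, then $G$ is isomorphic to $H(SB(1;b_1),X_1,X_2)$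 for some odd $b_1$ and some $X_1,X_2\in\{K_1,K_2\}$. (2) If $r\ge 3$, then $G$ is isomorphic to $H(K_2,K_1,K_1,K_1,K_1)$ or to $H(SaB(t;b_2),K_1,\dots,K_1)$ for some even $b_2\ge 0$, some $t\ge 0$ and some cycle length $g\ge 3$. -/

import Mathlib

namespace Wiener

/-- The Wiener index `W(G) = (1/2) * ∑ u, ∑ v, d(u, v)`. It is only used for connected graphs
(where `SimpleGraph.dist` is the graph distance). -/
noncomputable def wienerIndex {V : Type*} [Fintype V] (G : SimpleGraph V) : ℚ :=
  (1 / 2) * ∑ u : V, ∑ v : V, (G.dist u v : ℚ)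

/-- A subgraph `C` of `G` is a cycle if it is traced out by a closed walk that is a cycle. -/
def IsCycleSubgraph {V : Type*} {G : SimpleGraph V} (C : G.Subgraph) : Prop :=
  ∃ (v : V) (p : G.Walk v v), p.IsCycle ∧ p.toSubgraph = C

/-- A graph is unicyclic if it is connected and contains exactly one cycle (as a subgraph). -/
def IsUnicyclic {V : Type*} (G : SimpleGraph V) : Prop :=
  G.Connected ∧ ∃! C : G.Subgraph, IsCycleSubgraph C

open scoped Classical in
/-- The number of vertices of even degree. -/
noncomputable def evenDegreeCount {V : Type*} [Fintype V] (G : SimpleGraph V) : ℕ :=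
  (Finset.univ.filter fun v : V => Even (G.degree v)).card

/-- The unicyclic graphs with vertex set `V` and exactly `r` vertices of even degree. -/
def unicyclicFamily (V : Type*) [Fintype V] (r : ℕ) : Set (SimpleGraph V) :=
  {G | IsUnicyclic G ∧ evenDegreeCount G = r}

/-- A graph with a distinguished vertex. -/
structure RootedGraph where
  /-- the vertices -/
  V : Type
  /-- the graph -/
  graph : SimpleGraph V
  /-- the root -/
  root : V

/-- The one-vertex graph `K₁`. -/
def K₁ : RootedGraph := ⟨Fin 1, ⊤, 0⟩

/-- The complete graph `K₂`, rooted at one of its two ends. -/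
def K₂ : RootedGraph := ⟨Fin 2, ⊤, 0⟩

/-- The spider whose center `none` (the root) carries `b` branches, the `i`-th branch being a path
of length `len i` starting at the center; `some ⟨i, j⟩` is the vertex of the `i`-th branch
at distance `j + 1` from the center. -/
def spider {b : ℕ} (len : Fin b → ℕ) : RootedGraph where
  V := Option (Σ i : Fin b, Fin (len i))
  graph := SimpleGraph.fromRel fun x y =>
    match x, y with
    | none, some q => (q.2 : ℕ) = 0
    | some p, some q => p.1 = q.1 ∧ (p.2 : ℕ) + 1 = (q.2 : ℕ)
    | _, none => False
  root := none

/-- The balanced subdivided star `SB(t; b)`: `b` branches, each of length exactly `t`. -/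
def SB (t b : ℕ) : RootedGraph := spider fun _ : Fin b => t

/-- `S` is an almost balanced subdivided star `SaB(t; b)`: it has `b` (nontrivial) branches, each
of length `t` or `t - 1`, and at least one of length `t`. For `b = 0` it is the single vertex
`SaB(0; 0) = SB(0; 0) = K₁`. -/
def IsSaB (t b : ℕ) (S : RootedGraph) : Prop :=
  ∃ len : Fin b → ℕ, S = spider len ∧
    (∀ i, 1 ≤ len i ∧ (len i = t ∨ len i + 1 = t)) ∧
    (b = 0 → t = 0) ∧ (0 < b → ∃ i, len i = t)

/-- The embedding of the index set that sends `i` to the root of the `i`-th rooted graph. -/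
def rootEmbedding {ℓ : ℕ} (T : Fin ℓ → RootedGraph) : Fin ℓ ↪ (Σ i : Fin ℓ, (T i).V) where
  toFun i := ⟨i, (T i).root⟩
  inj' _ _ h := congrArg Sigma.fst h

/-- `H(T₀, …, T_{ℓ-1})`: the rooted graphs `T i` are placed disjointly, and their roots are joined,
in the given cyclic order, by a cycle of length `ℓ` (used for `3 ≤ ℓ`). -/
def H {ℓ : ℕ} (T : Fin ℓ → RootedGraph) : SimpleGraph (Σ i : Fin ℓ, (T i).V) :=
  (⨆ i : Fin ℓ, (T i).graph.map (Function.Embedding.sigmaMk (β := fun i => (T i).V) i)) ⊔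
    (SimpleGraph.cycleGraph ℓ).map (rootEmbedding T)

end Wiener

namespace Wiener

open Finset

/-! Orient every edge of a connected unicyclic graph towards the cycle or along it, so that the
graph becomes a self-map of its vertices (`CycleForest`). Edges off the cycle are cut edges. With
`n` vertices, cycle length `g` and `s_v` the size of the subtree at `v`, twice the Wiener index is
therefore `2 ∑ s_v (n - s_v) + ⌊g²/4⌋ (2n - g)` plus the spread, a weighted sum of cyclic distances
between the branches (`CycleForest.sum_dist`).

Let `r ≥ 3` and `b = n - r`. Leaves have odd degree, so there are at most `b` of them. Call `v` off
the cycle light if `s_v ≤ n/2`, and heavy otherwise; let `N` be the number of light vertices. A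
light subtree contains a path from `v` down to a leaf, and for at most `b j` vertices does the
chosen path have `j` vertices or fewer. As `s (n - s)` increases up to `n/2`, this bounds the light
contribution below, and for `b ≤ N` the bound is that of `b` balanced legs. The heavy vertices form
a path starting at the cycle, and absorbing them into the cycle is cheaper (`le_sum_heavy`). So for
`b ≤ N` a cycle with `b` balanced legs at one vertex does at least as well, and equality forces no
heavy vertices, zero spread and balance (`exists_balanced_iso`). For `b > N` each light vertex
contributes at least `n - 1`, and the comparison is with a cycle of length `r` carrying `b` pendant
edges. The shorter cycle wins, except for a tie at `n = 6` between the quadrilateral with two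
pendant edges and the pentagon with one: this is the exceptional graph (`minimal_cases`).

Let `r ≤ 2`. A cycle vertex carrying no branch has even degree, so at most `r` of them are bare,
which forces a positive spread when `r ≤ 1`. Every edge off the cycle contributes at least `n - 1`.
Comparison with a triangle carrying pendant edges gives `g = 3`, all subtrees trivial, and the
distribution of the leaves (`exists_shift_of_le`). -/

/-! ### Cyclic distance on `ZMod m`. -/

/-- The distance from `0` to `x` in the cycle of length `m`. -/
def cycleNorm {m : ℕ} (x : ZMod m) : ℕ := x.valMinAbs.natAbs

lemma cycleNorm_zero {m : ℕ} : cycleNorm (0 : ZMod m) = 0 := by simp [cycleNorm]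

lemma cycleNorm_neg {m : ℕ} (x : ZMod m) : cycleNorm (-x) = cycleNorm x :=
  ZMod.natAbs_valMinAbs_neg x

lemma cycleNorm_sub_comm {m : ℕ} (x y : ZMod m) : cycleNorm (x - y) = cycleNorm (y - x) := by
  rw [← cycleNorm_neg, neg_sub]

lemma cycleNorm_eq_min {m : ℕ} [NeZero m] (x : ZMod m) :
    cycleNorm x = min x.val (m - x.val) := ZMod.valMinAbs_natAbs_eq_min x

lemma cycleNorm_pos {m : ℕ} {x : ZMod m} (hx : x ≠ 0) : 1 ≤ cycleNorm x := by
  have := (ZMod.valMinAbs_eq_zero x).not.mpr hx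
  unfold cycleNorm
  omega

lemma cycleNorm_add_le {m : ℕ} (x y : ZMod m) :
    cycleNorm (x + y) ≤ cycleNorm x + cycleNorm y :=
  (ZMod.natAbs_valMinAbs_add_le x y).trans (Int.natAbs_add_le _ _)

lemma cycleNorm_one_le {m : ℕ} [NeZero m] : cycleNorm (1 : ZMod m) ≤ 1 := by
  rw [cycleNorm_eq_min]
  exact (min_le_left _ _).trans (by
    rw [ZMod.val_one_eq_one_mod]; exact Nat.mod_le _ _)

/-- Without its zeroth term, the sum for `g + 2` is the sum for `g` with every term raised by one
and an extra index `g` whose minimum is zero. Hence the induction by steps of two. -/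
lemma sum_range_min (g : ℕ) : ∑ i ∈ range g, min i (g - i) = g ^ 2 / 4 := by
  induction g using Nat.strong_induction_on with
  | _ g ih =>
    match g with
    | 0 => simp
    | 1 => simp
    | g + 2 =>
      rw [sum_range_succ']
      have : ∀ i ∈ range (g + 1), min (i + 1) (g + 2 - (i + 1)) = 1 + min i (g - i) := by
        intro i hi
        have := mem_range.1 hi
        omega
      rw [sum_congr rfl this, sum_add_distrib, sum_range_succ (fun i => min i (g - i)), ih g (by omega)]
      simp only [sum_const, card_range, smul_eq_mul]
      have : (g + 2) ^ 2 = g ^ 2 + (g + 1) * 4 := by ring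
      rw [this, Nat.add_mul_div_right _ _ (by norm_num)]
      simp
      omega

lemma sum_cycleNorm (k : ℕ) : ∑ x : ZMod (k + 3), cycleNorm x = (k + 3) ^ 2 / 4 := by
  rw [← sum_range_min, ← Fin.sum_univ_eq_sum_range (fun i => min i (k + 3 - i))]
  exact sum_congr rfl fun x _ => cycleNorm_eq_min x

/-! ### Unicyclic graphs as self-maps. -/

/-- A description of a connected unicyclic graph by a self-map `next` of its vertices: the edges
are the pairs `{v, next v}`, the map `next` rotates the cycle `cyc`, and it moves every other vertex
one step towards the cycle. `dep v` is the distance from `v` to the cycle, and `base v` is the index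
of the vertex of the cycle that is closest to `v`. -/
structure CycleForest {V : Type*} (G : SimpleGraph V) (k : ℕ) where
  /-- the neighbour of a vertex in the direction of the cycle, or along the cycle -/
  next : V → V
  /-- the cycle -/
  cyc : ZMod (k + 3) → V
  /-- the index of the nearest vertex of the cycle -/
  base : V → ZMod (k + 3)
  /-- the distance to the cycle -/
  dep : V → ℕ
  base_cyc : ∀ i, base (cyc i) = i
  dep_cyc : ∀ i, dep (cyc i) = 0
  cyc_base : ∀ v, dep v = 0 → cyc (base v) = v
  next_cyc : ∀ i, next (cyc i) = cyc (i + 1)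
  dep_next : ∀ v, dep v ≠ 0 → dep (next v) + 1 = dep v
  base_next : ∀ v, dep v ≠ 0 → base (next v) = base v
  adj_iff : ∀ u v, G.Adj u v ↔ next u = v ∨ next v = u

namespace CycleForest

variable {V : Type*} {G : SimpleGraph V} {k : ℕ} (F : CycleForest G k)
include F

lemma cyc_injective : Function.Injective F.cyc := fun i j h => by
  rw [← F.base_cyc i, h, F.base_cyc]

lemma dep_next_of_eq_zero {v : V} (h : F.dep v = 0) : F.dep (F.next v) = 0 := by
  rw [← F.cyc_base v h, F.next_cyc, F.dep_cyc]

lemma base_next_of_eq_zero {v : V} (h : F.dep v = 0) : F.base (F.next v) = F.base v + 1 := by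
  conv_lhs => rw [← F.cyc_base v h, F.next_cyc, F.base_cyc]

lemma dep_iterate {v : V} {j : ℕ} (h : j ≤ F.dep v) : F.dep (F.next^[j] v) = F.dep v - j := by
  induction j with
  | zero => simp
  | succ j ih =>
    have h1 := ih (by omega)
    rw [Function.iterate_succ_apply']
    have := F.dep_next (F.next^[j] v) (by omega)
    omega

lemma base_iterate {v : V} {j : ℕ} (h : j ≤ F.dep v) : F.base (F.next^[j] v) = F.base v := by
  induction j with
  | zero => simp
  | succ j ih =>
    rw [Function.iterate_succ_apply', F.base_next _ (by rw [F.dep_iterate (by omega)]; omega),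
      ih (by omega)]

lemma iterate_dep (v : V) : F.next^[F.dep v] v = F.cyc (F.base v) := by
  rw [← F.cyc_base (F.next^[F.dep v] v) (by rw [F.dep_iterate le_rfl]; omega),
    F.base_iterate le_rfl]

/-- `u` lies in the subtree hanging from `v`. -/
def Below (u v : V) : Prop := F.dep v ≤ F.dep u ∧ F.next^[F.dep u - F.dep v] u = v

lemma below_refl (v : V) : F.Below v v := by simp [Below]

variable {F}

lemma Below.dep_le {u v : V} (h : F.Below u v) : F.dep v ≤ F.dep u := h.1

lemma Below.base_eq {u v : V} (h : F.Below u v) : F.base u = F.base v := by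
  rw [← h.2, F.base_iterate (by omega)]

lemma Below.eq_of_dep_le {u v : V} (h : F.Below u v) (h' : F.dep u ≤ F.dep v) : u = v := by
  have := h.2
  rwa [Nat.sub_eq_zero_of_le h'] at this

lemma Below.antisymm {u v : V} (h : F.Below u v) (h' : F.Below v u) : u = v :=
  h.eq_of_dep_le h'.dep_le

lemma Below.trans {u v w : V} (h : F.Below u v) (h' : F.Below v w) : F.Below u w := by
  refine ⟨h'.1.trans h.1, ?_⟩
  have h1 := h.1
  have h2 := h'.1
  rw [show F.dep u - F.dep w = (F.dep v - F.dep w) + (F.dep u - F.dep v) by omega,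
    Function.iterate_add_apply, h.2, h'.2]

variable (F)

lemma below_iterate {u : V} {j : ℕ} (h : j ≤ F.dep u) : F.Below u (F.next^[j] u) := by
  have := F.dep_iterate h
  refine ⟨by omega, ?_⟩
  rw [this, Nat.sub_sub_self h]

lemma below_next {u : V} (h : F.dep u ≠ 0) : F.Below u (F.next u) :=
  F.below_iterate (j := 1) (by omega)

/-- Two vertices above a common vertex are comparable. -/
lemma below_of_below {u v w : V} (hv : F.Below u v) (hw : F.Below u w)
    (h : F.dep w ≤ F.dep v) : F.Below v w := by
  refine ⟨h, ?_⟩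
  have h1 := hv.1
  have h2 : F.next^[F.dep v - F.dep w] (F.next^[F.dep u - F.dep v] u) = w := by
    rw [← Function.iterate_add_apply,
      show F.dep v - F.dep w + (F.dep u - F.dep v) = F.dep u - F.dep w by omega, hw.2]
  rwa [hv.2] at h2

lemma below_next_iff {u v : V} (hu : F.dep u ≠ 0) (huv : u ≠ v) :
    F.Below (F.next u) v ↔ F.Below u v := by
  refine ⟨fun h => (F.below_next hu).trans h, fun h => ?_⟩
  have h1 := F.dep_next u hu
  refine F.below_of_below (F.below_next hu) h ?_
  by_contra h2
  exact huv (h.eq_of_dep_le (by omega))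

lemma not_below_of_dep_eq_zero {u v : V} (hu : F.dep u = 0) (hv : F.dep v ≠ 0) :
    ¬ F.Below u v := fun h => by have := h.dep_le; omega

/-! ### Distances as counts of separating cut edges plus cyclic distance. -/

section dist

variable [Fintype V]

open scoped Classical in
/-- The vertices off the cycle whose subtree separates `u` from `w`. -/
noncomputable def separators (u w : V) : Finset V :=
  univ.filter fun v => F.dep v ≠ 0 ∧ Xor (F.Below u v) (F.Below w v)

/-- The number of cut edges separating `u` from `w`, plus the distance of their feet along the
cycle. -/
noncomputable def cutDist (u w : V) : ℕ :=
  (F.separators u w).card + cycleNorm (F.base u - F.base w)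

lemma mem_separators {u w v : V} :
    v ∈ F.separators u w ↔ F.dep v ≠ 0 ∧ Xor (F.Below u v) (F.Below w v) := by
  simp [separators]

lemma separators_comm (u w : V) : F.separators u w = F.separators w u := by
  ext v
  rw [mem_separators, mem_separators, xor_comm]

lemma cutDist_comm (u w : V) : F.cutDist u w = F.cutDist w u := by
  rw [cutDist, cutDist, separators_comm, cycleNorm_sub_comm]

lemma cutDist_self (u : V) : F.cutDist u u = 0 := by
  simp [cutDist, separators, cycleNorm_zero]

lemma mem_separators_next_iff {u w v : V} (huv : u ≠ v) :
    v ∈ F.separators (F.next u) w ↔ v ∈ F.separators u w := by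
  rw [mem_separators, mem_separators]
  refine and_congr_right fun hv => ?_
  by_cases hu : F.dep u = 0
  · have h1 := F.not_below_of_dep_eq_zero hu hv
    have h2 := F.not_below_of_dep_eq_zero (F.dep_next_of_eq_zero hu) hv
    simp [h1, h2, Xor]
  · rw [F.below_next_iff hu huv]

lemma separators_next_of_dep_eq_zero {u : V} (w : V) (hu : F.dep u = 0) :
    F.separators (F.next u) w = F.separators u w := by
  ext v
  by_cases huv : u = v
  · subst huv
    simp [mem_separators, hu]
  · exact F.mem_separators_next_iff huv

lemma erase_separators_next (u w : V) [DecidableEq V] :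
    (F.separators (F.next u) w).erase u = (F.separators u w).erase u := by
  ext v
  rw [mem_erase, mem_erase]
  exact and_congr_right fun h => F.mem_separators_next_iff h.symm

/-- A step on the cycle changes only the cyclic term, by at most one; a step off the cycle changes
only the membership of `u` among the separators. So `cutDist` is 1-Lipschitz along edges and bounds
the distance from below. -/
lemma cutDist_next_le (u w : V) :
    F.cutDist (F.next u) w ≤ F.cutDist u w + 1 ∧ F.cutDist u w ≤ F.cutDist (F.next u) w + 1 := by
  classical
  unfold cutDist
  by_cases hu : F.dep u = 0
  · rw [F.separators_next_of_dep_eq_zero w hu, F.base_next_of_eq_zero hu]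
    have h1 := cycleNorm_add_le (F.base u - F.base w) 1
    have h2 := cycleNorm_add_le (F.base u + 1 - F.base w) (-1)
    rw [cycleNorm_neg] at h2
    have h3 : cycleNorm (1 : ZMod (k + 3)) ≤ 1 := cycleNorm_one_le
    rw [show F.base u - F.base w + 1 = F.base u + 1 - F.base w by ring] at h1
    rw [show F.base u + 1 - F.base w + -1 = F.base u - F.base w by ring] at h2
    omega
  · rw [F.base_next u hu]
    have h1 := congrArg card (F.erase_separators_next u w)
    have h2 := card_erase_le (s := F.separators u w) (a := u)
    have h3 := card_erase_le (s := F.separators (F.next u) w) (a := u)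
    have h4 := pred_card_le_card_erase (s := F.separators u w) (a := u)
    have h5 := pred_card_le_card_erase (s := F.separators (F.next u) w) (a := u)
    omega

/-- The step crosses the cut edge above `u`: `u` separates before it and no longer after it. These
are the steps of a geodesic. -/
lemma cutDist_next_of_not_below {u w : V} (hu : F.dep u ≠ 0) (h : ¬ F.Below w u) :
    F.cutDist (F.next u) w + 1 = F.cutDist u w := by
  classical
  unfold cutDist
  rw [F.base_next u hu]
  have h1 := F.erase_separators_next u w
  have h2 : u ∉ F.separators (F.next u) w := by
    rw [mem_separators]
    rintro ⟨-, h3⟩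
    rcases h3 with h3 | h3
    · have := h3.1.dep_le
      have := F.dep_next u hu
      omega
    · exact h h3.1
  have h3 : u ∈ F.separators u w := F.mem_separators.2 ⟨hu, Or.inl ⟨F.below_refl u, h⟩⟩
  rw [erase_eq_of_notMem h2] at h1
  have h4 := card_erase_add_one h3
  rw [h1]
  omega

lemma cutDist_le_of_adj {u v : V} (h : G.Adj u v) (w : V) :
    F.cutDist u w ≤ F.cutDist v w + 1 := by
  rcases (F.adj_iff u v).1 h with rfl | rfl
  · exact (F.cutDist_next_le u w).2
  · exact (F.cutDist_next_le v w).1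

lemma cutDist_le_length {u w : V} (p : G.Walk u w) : F.cutDist u w ≤ p.length := by
  induction p with
  | nil => simp [cutDist_self]
  | cons h p ih =>
    have := F.cutDist_le_of_adj h
    rw [SimpleGraph.Walk.length_cons]
    exact (this _).trans (by omega)

omit [Fintype V] in
lemma adj_next (u : V) : G.Adj u (F.next u) := (F.adj_iff _ _).2 (Or.inl rfl)

omit [Fintype V] in
lemma exists_walk_cyc_add (i : ZMod (k + 3)) (j : ℕ) :
    ∃ p : G.Walk (F.cyc i) (F.cyc (i + j)), p.length = j := by
  induction j with
  | zero => exact ⟨SimpleGraph.Walk.nil.copy rfl (by simp), by simp⟩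
  | succ j ih =>
    obtain ⟨p, hp⟩ := ih
    have h : G.Adj (F.cyc (i + j)) (F.cyc (i + (j + 1 : ℕ))) := by
      have := F.adj_next (F.cyc (i + j))
      rw [F.next_cyc] at this
      rwa [Nat.cast_succ, ← add_assoc]
    exact ⟨p.concat h, by simp [hp]⟩

omit [Fintype V] in
lemma exists_walk_cyc (i j : ZMod (k + 3)) :
    ∃ p : G.Walk (F.cyc i) (F.cyc j), p.length = cycleNorm (i - j) := by
  rcases le_total 0 (i - j).valMinAbs with h | h
  · obtain ⟨p, hp⟩ := F.exists_walk_cyc_add j (cycleNorm (i - j))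
    have h1 : j + (cycleNorm (i - j) : ℕ) = i := by
      have : ((i - j).valMinAbs : ZMod (k + 3)) = i - j := ZMod.coe_valMinAbs _
      have h2 : ((cycleNorm (i - j) : ℕ) : ZMod (k + 3)) = ((i - j).valMinAbs : ZMod (k + 3)) := by
        rw [cycleNorm, ← Int.cast_natCast, Int.natAbs_of_nonneg h]
      rw [h2, this]; ring
    exact ⟨p.reverse.copy (by rw [h1]) rfl, by simp [hp]⟩
  · obtain ⟨p, hp⟩ := F.exists_walk_cyc_add i (cycleNorm (i - j))
    have h1 : i + (cycleNorm (i - j) : ℕ) = j := by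
      have : ((i - j).valMinAbs : ZMod (k + 3)) = i - j := ZMod.coe_valMinAbs _
      have h2 : ((cycleNorm (i - j) : ℕ) : ZMod (k + 3)) = -((i - j).valMinAbs : ZMod (k + 3)) := by
        rw [cycleNorm, ← Int.cast_natCast, Int.ofNat_natAbs_of_nonpos h, Int.cast_neg]
      rw [h2, this]; ring
    exact ⟨p.copy rfl (by rw [h1]), by simp [hp]⟩

/-- An end that is off the cycle and not above the other end moves towards the cycle, at the exact
price of one. If neither end can move and they differ, both are on the cycle, where an arc finishes
the walk. -/
lemma exists_walk_length_eq_cutDist (u w : V) :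
    ∃ p : G.Walk u w, p.length = F.cutDist u w := by
  induction hm : F.dep u + F.dep w using Nat.strong_induction_on generalizing u w with
  | _ m ih =>
    by_cases huw : u = w
    · subst huw
      exact ⟨.nil, by simp [cutDist_self]⟩
    by_cases hu : F.dep u ≠ 0 ∧ ¬ F.Below w u
    · have hd := F.dep_next u hu.1
      obtain ⟨p, hp⟩ := ih (F.dep (F.next u) + F.dep w) (by omega) (F.next u) w rfl
      refine ⟨.cons (F.adj_next u) p, ?_⟩
      rw [SimpleGraph.Walk.length_cons, hp, F.cutDist_next_of_not_below hu.1 hu.2]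
    by_cases hw : F.dep w ≠ 0 ∧ ¬ F.Below u w
    · have hd := F.dep_next w hw.1
      obtain ⟨p, hp⟩ := ih (F.dep u + F.dep (F.next w)) (by omega) u (F.next w) rfl
      refine ⟨p.concat (F.adj_next w).symm, ?_⟩
      rw [SimpleGraph.Walk.length_concat, hp, F.cutDist_comm, F.cutDist_comm u w,
        F.cutDist_next_of_not_below hw.1 hw.2]
    have hu0 : F.dep u = 0 := by
      by_contra h0
      have h1 : F.Below w u := by by_contra h1; exact hu ⟨h0, h1⟩
      have h2 : F.dep w ≠ 0 := by have := h1.dep_le; omega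
      have h3 : F.Below u w := by by_contra h3; exact hw ⟨h2, h3⟩
      exact huw (h3.antisymm h1)
    have hw0 : F.dep w = 0 := by
      by_contra h0
      exact hw ⟨h0, F.not_below_of_dep_eq_zero hu0 h0⟩
    obtain ⟨p, hp⟩ := F.exists_walk_cyc (F.base u) (F.base w)
    refine ⟨p.copy (F.cyc_base u hu0) (F.cyc_base w hw0), ?_⟩
    rw [SimpleGraph.Walk.length_copy, hp, cutDist]
    have : F.separators u w = ∅ := by
      ext v
      simp only [mem_separators, notMem_empty, iff_false]
      rintro ⟨hv, h | h⟩
      · exact F.not_below_of_dep_eq_zero hu0 hv h.1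
      · exact F.not_below_of_dep_eq_zero hw0 hv h.1
    simp [this]

lemma connected : G.Connected := by
  have : Nonempty V := ⟨F.cyc 0⟩
  exact ⟨fun u w => ⟨(F.exists_walk_length_eq_cutDist u w).choose⟩⟩

lemma dist_eq_cutDist (u w : V) : G.dist u w = F.cutDist u w := by
  obtain ⟨p, hp⟩ := F.exists_walk_length_eq_cutDist u w
  refine le_antisymm (hp ▸ SimpleGraph.dist_le p) ?_
  obtain ⟨q, hq⟩ := F.connected.exists_walk_length_eq_dist u w
  exact hq ▸ F.cutDist_le_length q

end dist

end CycleForest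

/-! ### The formula for the Wiener index. -/

lemma wienerIndex_eq {V : Type*} [Fintype V] (G : SimpleGraph V) :
    wienerIndex G = ((∑ u : V, ∑ v : V, G.dist u v : ℕ) : ℚ) / 2 := by
  rw [wienerIndex]
  push_cast
  ring

namespace CycleForest

variable {V : Type*} {G : SimpleGraph V} {k : ℕ} (F : CycleForest G k) [Fintype V]
include F

open scoped Classical in
/-- The vertices off the cycle. -/
noncomputable def offCycle : Finset V := univ.filter fun v => F.dep v ≠ 0

open scoped Classical in
/-- The number of vertices in the subtree of `v`. -/
noncomputable def size (v : V) : ℕ := (univ.filter fun u => F.Below u v).card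

open scoped Classical in
/-- The number of vertices off the cycle that hang from the `i`-th vertex of the cycle. -/
noncomputable def weight (i : ZMod (k + 3)) : ℕ :=
  (F.offCycle.filter fun v => F.base v = i).card

/-- The total distance between the parts of the graph off the cycle, measured along the cycle. -/
noncomputable def spread : ℕ :=
  ∑ i : ZMod (k + 3), ∑ j : ZMod (k + 3), F.weight i * F.weight j * cycleNorm (i - j)

lemma mem_offCycle {v : V} : v ∈ F.offCycle ↔ F.dep v ≠ 0 := by simp [offCycle]

lemma card_separators (u w : V) [DecidablePred fun v => Xor (F.Below u v) (F.Below w v)] :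
    (F.separators u w).card = ∑ v ∈ F.offCycle, if Xor (F.Below u v) (F.Below w v) then 1 else 0 := by
  classical
  rw [← card_filter]
  congr 1
  ext v
  simp [mem_separators, mem_offCycle]

lemma size_le_card (v : V) : F.size v ≤ Fintype.card V := card_le_univ _

omit F in
lemma sum_sum_ite_xor (P : V → Prop) [DecidablePred P] [∀ u w, Decidable (Xor (P u) (P w))] :
    ∑ u, ∑ w, (if Xor (P u) (P w) then 1 else 0) =
      2 * ((univ.filter P).card * (Fintype.card V - (univ.filter P).card)) := by
  have h1 : ∀ u w, (if Xor (P u) (P w) then 1 else 0) =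
      (if P u then 1 else 0) * (if ¬ P w then 1 else 0) +
        (if ¬ P u then 1 else 0) * (if P w then 1 else 0) := by
    intro u w
    by_cases hu : P u <;> by_cases hw : P w <;> simp [hu, hw, Xor]
  have h2 : (univ.filter fun v => ¬ P v).card = Fintype.card V - (univ.filter P).card := by
    rw [← card_univ, ← card_filter_add_card_filter_not (s := univ) P]
    omega
  simp_rw [h1, sum_add_distrib, ← mul_sum, ← sum_mul, ← card_filter, h2]
  ring

lemma sum_sum_card_separators :
    ∑ u, ∑ w, (F.separators u w).card =
      2 * ∑ v ∈ F.offCycle, F.size v * (Fintype.card V - F.size v) := by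
  classical
  simp_rw [card_separators]
  calc _ = ∑ u, ∑ v ∈ F.offCycle, ∑ w, (if Xor (F.Below u v) (F.Below w v) then 1 else 0) :=
        sum_congr rfl fun u _ => sum_comm
    _ = ∑ v ∈ F.offCycle, ∑ u, ∑ w, (if Xor (F.Below u v) (F.Below w v) then 1 else 0) := sum_comm
    _ = _ := by
      rw [mul_sum]
      refine sum_congr rfl fun v _ => ?_
      rw [sum_sum_ite_xor (fun u => F.Below u v), size]

lemma card_filter_base (i : ZMod (k + 3)) [DecidablePred fun v => F.base v = i] :
    (univ.filter fun v => F.base v = i).card = F.weight i + 1 := by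
  classical
  have : (univ.filter fun v => F.base v = i) =
      insert (F.cyc i) (F.offCycle.filter fun v => F.base v = i) := by
    ext v
    simp only [mem_filter, mem_univ, true_and, mem_insert, mem_offCycle]
    refine ⟨fun h => ?_, ?_⟩
    · by_cases h0 : F.dep v = 0
      · exact Or.inl (by rw [← h, F.cyc_base v h0])
      · exact Or.inr ⟨h0, h⟩
    · rintro (rfl | h)
      · exact F.base_cyc i
      · exact h.2
  rw [this, card_insert_of_notMem (by simp [mem_offCycle, F.dep_cyc]), weight]
  congr!

lemma card_offCycle : F.offCycle.card + (k + 3) = Fintype.card V := by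
  classical
  have h := card_filter_add_card_filter_not (s := (univ : Finset V)) (fun v => F.dep v ≠ 0)
  have h1 : (univ.filter fun v => ¬ F.dep v ≠ 0) = univ.image F.cyc := by
    ext v
    simp only [mem_filter, mem_univ, true_and, mem_image, not_not]
    exact ⟨fun h => ⟨_, F.cyc_base v h⟩, fun ⟨i, hi⟩ => hi ▸ F.dep_cyc i⟩
  rw [h1, card_image_of_injective _ F.cyc_injective, card_univ, card_univ, ZMod.card] at h
  rw [← h, offCycle]

lemma sum_weight : ∑ i, F.weight i = F.offCycle.card := by
  classical
  rw [card_eq_sum_card_fiberwise (f := F.base) (t := univ) (by simp)]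
  exact sum_congr rfl fun i _ => by rw [weight]

omit F in
lemma sum_cycleNorm_sub_left (i : ZMod (k + 3)) :
    ∑ j : ZMod (k + 3), cycleNorm (i - j) = (k + 3) ^ 2 / 4 := by
  rw [← sum_cycleNorm]
  exact (Equiv.subLeft i).sum_comp cycleNorm

omit F in
lemma sum_cycleNorm_sub_right (j : ZMod (k + 3)) :
    ∑ i : ZMod (k + 3), cycleNorm (i - j) = (k + 3) ^ 2 / 4 := by
  rw [← sum_cycleNorm]
  exact (Equiv.subRight j).sum_comp cycleNorm

/-- The fibre of `base` over `i` has `weight i + 1` elements. In the expanded product the quadratic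
part is the spread; all other parts are row or column sums of the cyclic distance, equal to
`⌊g²/4⌋`. -/
lemma sum_sum_cycleNorm_base :
    ∑ u, ∑ w, cycleNorm (F.base u - F.base w) =
      (k + 3) ^ 2 / 4 * (2 * Fintype.card V - (k + 3)) + F.spread := by
  classical
  have h1 : ∀ f : ZMod (k + 3) → ℕ, ∑ u, f (F.base u) = ∑ i, (F.weight i + 1) * f i := by
    intro f
    rw [← sum_fiberwise univ F.base]
    refine sum_congr rfl fun i _ => ?_
    rw [← F.card_filter_base i, ← smul_eq_mul, ← sum_const]
    exact sum_congr rfl fun u hu => by rw [(mem_filter.1 hu).2]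
  rw [h1 fun i => ∑ w, cycleNorm (i - F.base w)]
  simp_rw [fun i => h1 fun j => cycleNorm (i - j)]
  simp_rw [add_mul, one_mul, sum_add_distrib, sum_cycleNorm_sub_left, mul_add, sum_add_distrib,
    mul_sum, ← sum_mul]
  rw [sum_comm (f := fun x i => F.weight i * cycleNorm (x - i))]
  simp_rw [← mul_sum, sum_cycleNorm_sub_right, ← sum_mul, F.sum_weight]
  have h2 := F.card_offCycle
  have h3 : 2 * Fintype.card V - (k + 3) = 2 * F.offCycle.card + (k + 3) := by omega
  rw [h3, spread]
  simp_rw [mul_sum, sum_const, card_univ, ZMod.card, smul_eq_mul, mul_assoc]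
  ring

/-- The formula for the Wiener index: each edge off the cycle contributes the product of the sizes
of its two sides, and the remainder is the contribution of the cycle. -/
lemma sum_dist : ∑ u, ∑ w, G.dist u w =
    2 * ∑ v ∈ F.offCycle, F.size v * (Fintype.card V - F.size v) +
      (k + 3) ^ 2 / 4 * (2 * Fintype.card V - (k + 3)) + F.spread := by
  simp_rw [F.dist_eq_cutDist, cutDist, sum_add_distrib]
  rw [F.sum_sum_card_separators, F.sum_sum_cycleNorm_base, add_assoc]

omit [Fintype V]

lemma cyc_add_two_ne (i : ZMod (k + 3)) : F.cyc (i + 1 + 1) ≠ F.cyc i := by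
  intro h
  have h1 := F.cyc_injective h
  rw [add_assoc, add_eq_left, one_add_one_eq_two] at h1
  have : ((2 : ℕ) : ZMod (k + 3)) = 0 := by exact_mod_cast h1
  rw [ZMod.natCast_eq_zero_iff] at this
  have := Nat.le_of_dvd (by norm_num) this
  omega

lemma next_next_ne (v : V) : F.next (F.next v) ≠ v := by
  intro h
  by_cases h0 : F.dep v = 0
  · rw [← F.cyc_base v h0, F.next_cyc, F.next_cyc] at h
    exact F.cyc_add_two_ne _ h
  · have h1 := F.dep_next v h0
    by_cases h2 : F.dep (F.next v) = 0
    · have := F.dep_next_of_eq_zero h2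
      rw [h] at this
      exact h0 this
    · have := F.dep_next _ h2
      rw [h] at this
      omega

variable [Fintype V]

lemma degree_eq (v : V) [Fintype (G.neighborSet v)] [DecidableEq V] :
    G.degree v = (univ.filter fun u => F.next u = v).card + 1 := by
  have : G.neighborFinset v = insert (F.next v) (univ.filter fun u => F.next u = v) := by
    ext u
    simp [F.adj_iff, eq_comm (a := F.next v)]
  rw [← SimpleGraph.card_neighborFinset_eq_degree, this, card_insert_of_notMem]
  simpa using F.next_next_ne v

omit [Fintype V] in
lemma injective_edge : Function.Injective fun v => s(v, F.next v) := by
  intro u v h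
  rcases Sym2.eq_iff.1 h with h | h
  · exact h.1
  · exact absurd (by rw [h.2, ← h.1]) (F.next_next_ne u)

lemma card_edgeSet : Nat.card G.edgeSet = Fintype.card V := by
  rw [← Nat.card_eq_fintype_card]
  refine (Nat.card_congr (Equiv.ofBijective
    (fun v => (⟨s(v, F.next v), F.adj_next v⟩ : G.edgeSet)) ⟨?_, ?_⟩)).symm
  · intro u v h
    exact F.injective_edge (congrArg Subtype.val h)
  · rintro ⟨e, he⟩
    induction e with
    | _ u v =>
      rcases (F.adj_iff u v).1 he with rfl | rfl
      · exact ⟨u, rfl⟩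
      · exact ⟨v, Subtype.ext Sym2.eq_swap⟩

end CycleForest

/-! ### A graph with a functional description is unicyclic. -/

namespace CycleForest

variable {V : Type*} {G : SimpleGraph V} {k : ℕ} (F : CycleForest G k)
include F

/-- A deepest vertex of a cycle has two neighbours in it, but off `cyc` the only neighbour that is
not deeper is `next`. -/
lemma cycle_le_dep_eq_zero {a : V} {p : G.Walk a a} (hp : p.IsCycle) {v : V}
    (hv : v ∈ p.support) : F.dep v = 0 := by
  classical
  obtain ⟨w, hw, hmax⟩ := p.support.toFinset.exists_max_image F.dep ⟨v, by simpa using hv⟩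
  have h0 : F.dep w = 0 := by
    by_contra h0
    have h2 := hp.ncard_neighborSet_toSubgraph_eq_two (by simpa using hw)
    have h3 : p.toSubgraph.neighborSet w ⊆ {F.next w} := by
      intro x hx
      have hx' : p.toSubgraph.Adj w x := hx
      have hxs : x ∈ p.support := p.mem_verts_toSubgraph.1 hx'.snd_mem
      have hle := hmax x (by simpa using hxs)
      rcases (F.adj_iff w x).1 hx'.adj_sub with h | h
      · exact h.symm
      · exfalso
        by_cases hx0 : F.dep x = 0
        · exact h0 (h ▸ F.dep_next_of_eq_zero hx0)
        · have := F.dep_next x hx0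
          rw [h] at this
          omega
    have := Set.ncard_le_ncard h3
    rw [h2, Set.ncard_singleton] at this
    omega
  have := hmax v (by simpa using hv)
  omega

lemma cycle_adj_iff {a : V} {p : G.Walk a a} (hp : p.IsCycle) {i : ZMod (k + 3)}
    (hi : F.cyc i ∈ p.support) (x : V) :
    p.toSubgraph.Adj (F.cyc i) x ↔ x = F.cyc (i + 1) ∨ x = F.cyc (i - 1) := by
  have h2 := hp.ncard_neighborSet_toSubgraph_eq_two hi
  have h3 : p.toSubgraph.neighborSet (F.cyc i) ⊆ {F.cyc (i + 1), F.cyc (i - 1)} := by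
    intro x hx
    have hx' : p.toSubgraph.Adj (F.cyc i) x := hx
    have hx0 := F.cycle_le_dep_eq_zero hp (p.mem_verts_toSubgraph.1 hx'.snd_mem)
    rcases (F.adj_iff _ x).1 hx'.adj_sub with h | h
    · left
      rw [← h, F.next_cyc]
    · right
      rw [← F.cyc_base x hx0, F.next_cyc] at h
      rw [← F.cyc_injective h, add_sub_cancel_right, F.cyc_base x hx0]
      rfl
  have h4 : ({F.cyc (i + 1), F.cyc (i - 1)} : Set V).ncard ≤
      (p.toSubgraph.neighborSet (F.cyc i)).ncard := by
    rw [h2]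
    exact (Set.ncard_insert_le _ _).trans (by rw [Set.ncard_singleton])
  have h5 := Set.eq_of_subset_of_ncard_le h3 h4
  rw [← SimpleGraph.Subgraph.mem_neighborSet, h5]
  simp

lemma cyc_mem_cycle {a : V} {p : G.Walk a a} (hp : p.IsCycle) (i : ZMod (k + 3)) :
    F.cyc i ∈ p.support := by
  have h0 := F.cycle_le_dep_eq_zero hp p.start_mem_support
  have h1 : ∀ j : ℕ, F.cyc (F.base a + j) ∈ p.support := by
    intro j
    induction j with
    | zero =>
      rw [Nat.cast_zero, add_zero, F.cyc_base a h0]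
      exact p.start_mem_support
    | succ j ih =>
      have := (F.cycle_adj_iff hp ih _).2 (Or.inl rfl)
      rw [Nat.cast_succ, ← add_assoc]
      exact p.mem_verts_toSubgraph.1 this.snd_mem
  have := h1 (i - F.base a).val
  rwa [ZMod.natCast_zmod_val, add_sub_cancel] at this

lemma cycle_toSubgraph_le {a b : V} {p : G.Walk a a} {q : G.Walk b b} (hp : p.IsCycle)
    (hq : q.IsCycle) : p.toSubgraph ≤ q.toSubgraph := by
  have h : ∀ v ∈ p.support, v = F.cyc (F.base v) := fun v hv =>
    (F.cyc_base v (F.cycle_le_dep_eq_zero hp hv)).symm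
  refine ⟨fun v hv => ?_, fun v w hvw => ?_⟩
  · have hv' := p.mem_verts_toSubgraph.1 hv
    rw [h v hv']
    exact q.mem_verts_toSubgraph.2 (F.cyc_mem_cycle hq _)
  · have hv := h v (p.mem_verts_toSubgraph.1 hvw.fst_mem)
    rw [hv] at hvw ⊢
    exact (F.cycle_adj_iff hq (F.cyc_mem_cycle hq _) w).2
      ((F.cycle_adj_iff hp (F.cyc_mem_cycle hp _) w).1 hvw)

variable [Fintype V]

/-- A cycle exists because a tree would have one edge fewer than vertices; any two coincide because
each runs through all of `cyc`. -/
lemma isUnicyclic : IsUnicyclic G := by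
  refine ⟨F.connected, ?_⟩
  have h1 : ¬ G.IsAcyclic := by
    intro h
    have h2 := (SimpleGraph.isTree_iff_connected_and_card.1 ⟨F.connected, h⟩).2
    rw [F.card_edgeSet, Nat.card_eq_fintype_card] at h2
    omega
  unfold SimpleGraph.IsAcyclic at h1
  push Not at h1
  obtain ⟨v, p, hp⟩ := h1
  refine ⟨p.toSubgraph, ⟨v, p, hp, rfl⟩, ?_⟩
  rintro _ ⟨w, q, hq, rfl⟩
  exact le_antisymm (F.cycle_toSubgraph_le hq hp) (F.cycle_toSubgraph_le hp hq)

end CycleForest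

/-! ### A unicyclic graph has a functional description. -/

section

variable {V : Type*} {G : SimpleGraph V}

/-- Deleting an edge of the unique cycle leaves a connected graph without cycles, that is, a tree.
-/
lemma IsUnicyclic.card_edgeSet [Fintype V] (hG : IsUnicyclic G) :
    Nat.card G.edgeSet = Fintype.card V := by
  classical
  obtain ⟨hc, C, ⟨v, p, hp, rfl⟩, huniq⟩ := hG
  have hadj : G.Adj v p.snd := p.adj_snd hp.not_nil
  have hmem : s(v, p.snd) ∈ p.edges := by
    rw [← SimpleGraph.Walk.adj_toSubgraph_iff_mem_edges]
    exact p.toSubgraph_adj_snd hp.not_nil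
  have hconn := hc.connected_delete_edge_of_not_isBridge (x := v) (y := p.snd)
    (fun h => h.notMem_edges_of_isCycle hp hmem)
  have hacyc : (G.deleteEdges {s(v, p.snd)}).IsAcyclic := by
    intro w q hq
    have hle : G.deleteEdges {s(v, p.snd)} ≤ G := SimpleGraph.deleteEdges_le _
    have h1 := huniq _ ⟨w, q.mapLe hle, hq.mapLe hle, rfl⟩
    have h2 : (q.mapLe hle).toSubgraph.Adj v p.snd := by
      rw [h1]
      exact p.toSubgraph_adj_snd hp.not_nil
    rw [SimpleGraph.Walk.adj_toSubgraph_mapLe] at h2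
    have := h2.adj_sub
    simp at this
  have h3 := (SimpleGraph.isTree_iff_connected_and_card.1 ⟨hconn, hacyc⟩).2
  rw [SimpleGraph.edgeSet_deleteEdges, Nat.card_eq_fintype_card (α := V)] at h3
  rw [← h3]
  change Set.ncard G.edgeSet = Set.ncard (G.edgeSet \ {s(v, p.snd)}) + 1
  rw [Set.ncard_sdiff_singleton_add_one (by exact hadj) (Set.toFinite _)]

lemma exists_adj_dist_add_one (hc : G.Connected) {u v : V} (h : u ≠ v) :
    ∃ x, G.Adj u x ∧ G.dist x v + 1 = G.dist u v := by
  obtain ⟨p, hp⟩ := hc.exists_walk_length_eq_dist u v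
  cases p with
  | nil => exact absurd rfl h
  | @cons _ x _ hadj q =>
    refine ⟨x, hadj, ?_⟩
    rw [SimpleGraph.Walk.length_cons] at hp
    have h1 := SimpleGraph.dist_le q
    have h2 := hc.dist_triangle (u := u) (v := x) (w := v)
    rw [SimpleGraph.dist_eq_one_iff_adj.2 hadj] at h2
    omega

lemma exists_cyc {v : V} {p : G.Walk v v} (hp : p.IsCycle) :
    ∃ (k : ℕ) (c : ZMod (k + 3) → V), Function.Injective c ∧ ∀ i, G.Adj (c i) (c (i + 1)) := by
  have h3 := hp.three_le_length
  obtain ⟨k, hk⟩ := Nat.exists_eq_add_of_le' h3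
  refine ⟨k, fun i => p.getVert i.val, fun i j hij => ?_, fun i => ?_⟩
  · have hi := ZMod.val_lt i
    have hj := ZMod.val_lt j
    exact ZMod.val_injective _ (hp.getVert_injOn' (by simp only [Set.mem_ofPred_eq]; omega)
      (by simp only [Set.mem_ofPred_eq]; omega) hij)
  · have hi := ZMod.val_lt i
    have h1 : p.getVert (i + 1).val = p.getVert (i.val + 1) := by
      rw [ZMod.val_add, ZMod.val_one_eq_one_mod, Nat.mod_eq_of_lt (show 1 < k + 3 by omega)]
      rcases (show i.val + 1 < k + 3 ∨ i.val + 1 = k + 3 by omega) with h | h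
      · rw [Nat.mod_eq_of_lt h]
      · rw [h, Nat.mod_self, ← hk, p.getVert_zero, p.getVert_length]
    beta_reduce
    rw [h1]
    exact p.adj_getVert_succ (by omega)

/-- Off the cycle, `next` is a first step of a shortest path to it. The edges `{v, next v}` are
distinct since `next (next v) ≠ v`, and there are as many of them as edges of `G`, so they are all
the edges. -/
lemma IsUnicyclic.exists_cycleForest [Fintype V] (hG : IsUnicyclic G) :
    ∃ k, Nonempty (CycleForest G k) := by
  classical
  have hcard := hG.card_edgeSet
  obtain ⟨hc, C, ⟨a, p, hp, rfl⟩, -⟩ := hG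
  obtain ⟨k, c, hinj, hadj⟩ := exists_cyc hp
  refine ⟨k, ?_⟩
  have hne : ∀ v : V, ∃ i, ∀ j, G.dist v (c i) ≤ G.dist v (c j) := by
    intro v
    obtain ⟨i, -, hi⟩ := exists_min_image univ (fun i => G.dist v (c i)) ⟨0, mem_univ _⟩
    exact ⟨i, fun j => hi j (mem_univ _)⟩
  choose near hnear using hne
  set dep : V → ℕ := fun v => G.dist v (c (near v)) with hdep
  have hdep_cyc : ∀ i, dep (c i) = 0 := fun i => by
    have := hnear (c i) i
    rw [SimpleGraph.dist_self] at this
    exact Nat.le_zero.1 this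
  have hnear_cyc : ∀ v, dep v = 0 → v = c (near v) := fun v hv =>
    hc.dist_eq_zero_iff.1 hv
  have hstep : ∀ v, ∃ x, G.Adj v x ∧ ((dep v ≠ 0 ∧ dep x + 1 = dep v) ∨
      (dep v = 0 ∧ x = c (near v + 1))) := by
    intro v
    by_cases hv : dep v = 0
    · refine ⟨c (near v + 1), ?_, Or.inr ⟨hv, rfl⟩⟩
      have := hadj (near v)
      rwa [← hnear_cyc v hv] at this
    · obtain ⟨x, hx, hxd⟩ := exists_adj_dist_add_one hc (u := v) (v := c (near v))
        (fun h => hv (by rw [h]; exact hdep_cyc _))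
      refine ⟨x, hx, Or.inl ⟨hv, ?_⟩⟩
      have h1 := hnear x (near v)
      have h2 := hnear v (near x)
      have h3 := hc.dist_triangle (u := v) (v := x) (w := c (near x))
      rw [SimpleGraph.dist_eq_one_iff_adj.2 hx] at h3
      simp only [hdep]
      omega
  choose next hnext hnextd using hstep
  have hdep_next : ∀ v, dep v ≠ 0 → dep (next v) + 1 = dep v := fun v hv => by
    rcases hnextd v with h | h
    · exact h.2
    · exact absurd h.1 hv
  have hnext_cyc : ∀ i, next (c i) = c (i + 1) := fun i => by
    rcases hnextd (c i) with h | h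
    · exact absurd (hdep_cyc i) h.1
    · rw [h.2, hinj (hnear_cyc (c i) (hdep_cyc i)).symm]
  have hdep_next' : ∀ v, dep v = 0 → dep (next v) = 0 := fun v hv => by
    rw [hnear_cyc v hv, hnext_cyc, hdep_cyc]
  have hnn : ∀ v, next (next v) ≠ v := by
    intro v h
    by_cases h0 : dep v = 0
    · rw [hnear_cyc v h0, hnext_cyc, hnext_cyc] at h
      have h1 := hinj h
      rw [add_assoc, add_eq_left, one_add_one_eq_two] at h1
      have : ((2 : ℕ) : ZMod (k + 3)) = 0 := by exact_mod_cast h1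
      rw [ZMod.natCast_eq_zero_iff] at this
      have := Nat.le_of_dvd (by norm_num) this
      omega
    · have h1 := hdep_next v h0
      by_cases h2 : dep (next v) = 0
      · have := hdep_next' _ h2
        rw [h] at this
        exact h0 this
      · have := hdep_next _ h2
        rw [h] at this
        omega
  have hinjE : Function.Injective fun v => (⟨s(v, next v), hnext v⟩ : G.edgeSet) := by
    intro u v h
    rcases Sym2.eq_iff.1 (congrArg Subtype.val h) with h | h
    · exact h.1
    · exact absurd (by rw [h.2, ← h.1]) (hnn u)
  have hsurj : Function.Surjective fun v => (⟨s(v, next v), hnext v⟩ : G.edgeSet) := by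
    refine ((Fintype.bijective_iff_injective_and_card _).2 ⟨hinjE, ?_⟩).2
    rw [← Nat.card_eq_fintype_card, ← Nat.card_eq_fintype_card, hcard, Nat.card_eq_fintype_card]
  refine ⟨{ next := next, cyc := c, dep := dep, base := fun v => near (next^[dep v] v),
            base_cyc := fun i => ?_, dep_cyc := hdep_cyc, cyc_base := fun v hv => ?_,
            next_cyc := hnext_cyc, dep_next := hdep_next, base_next := fun v hv => ?_,
            adj_iff := fun u v => ⟨fun h => ?_, ?_⟩ }⟩
  · rw [hdep_cyc]
    exact hinj (hnear_cyc (c i) (hdep_cyc i)).symm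
  · rw [hv]
    exact (hnear_cyc v hv).symm
  · rw [← hdep_next v hv]
    rfl
  · obtain ⟨w, hw⟩ := hsurj ⟨s(u, v), h⟩
    rcases Sym2.eq_iff.1 (congrArg Subtype.val hw) with h | h
    · left; rw [← h.1, h.2]
    · right; rw [← h.1, h.2]
  · rintro (rfl | rfl)
    · exact hnext u
    · exact (hnext v).symm

end

/-! ### Rooted isomorphisms, the graphs `H` and spiders. -/

/-- An isomorphism of rooted graphs. -/
def RootedIso (A B : RootedGraph) : Prop := ∃ e : A.graph ≃g B.graph, e A.root = B.root

lemma RootedIso.refl (A : RootedGraph) : RootedIso A A := ⟨SimpleGraph.Iso.refl, rfl⟩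

lemma H_adj {ℓ : ℕ} (T : Fin ℓ → RootedGraph) (x y : Σ i : Fin ℓ, (T i).V) :
    (H T).Adj x y ↔ (∃ i a b, (T i).graph.Adj a b ∧ x = ⟨i, a⟩ ∧ y = ⟨i, b⟩) ∨
      ∃ i j, (SimpleGraph.cycleGraph ℓ).Adj i j ∧ x = ⟨i, (T i).root⟩ ∧ y = ⟨j, (T j).root⟩ := by
  unfold H
  simp only [SimpleGraph.sup_adj, SimpleGraph.iSup_adj, SimpleGraph.map_adj]
  constructor
  · rintro (⟨i, a, b, h, rfl, rfl⟩ | ⟨i, j, h, rfl, rfl⟩)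
    · exact Or.inl ⟨i, a, b, h, rfl, rfl⟩
    · exact Or.inr ⟨i, j, h, rfl, rfl⟩
  · rintro (⟨i, a, b, h, rfl, rfl⟩ | ⟨i, j, h, rfl, rfl⟩)
    · exact Or.inl ⟨i, a, b, h, rfl, rfl⟩
    · exact Or.inr ⟨i, j, h, rfl, rfl⟩

lemma H_adj_sigmaMap {ℓ : ℕ} {T T' : Fin ℓ → RootedGraph}
    (f : ∀ i, (T i).graph ≃g (T' i).graph) (hf : ∀ i, f i (T i).root = (T' i).root)
    {x y : Σ i : Fin ℓ, (T i).V} (h : (H T).Adj x y) :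
    (H T').Adj ⟨x.1, f x.1 x.2⟩ ⟨y.1, f y.1 y.2⟩ := by
  rw [H_adj] at h ⊢
  rcases h with ⟨i, a, b, h, rfl, rfl⟩ | ⟨i, j, h, rfl, rfl⟩
  · exact Or.inl ⟨i, f i a, f i b, (f i).map_rel_iff.2 h, rfl, rfl⟩
  · exact Or.inr ⟨i, j, h, by rw [hf], by rw [hf]⟩

lemma H_congr {ℓ : ℕ} {T T' : Fin ℓ → RootedGraph} (h : ∀ i, RootedIso (T i) (T' i)) :
    Nonempty (H T ≃g H T') := by
  choose f hf using h
  refine ⟨⟨Equiv.sigmaCongrRight fun i => (f i).toEquiv, ?_⟩⟩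
  intro x y
  refine ⟨fun hxy => ?_, fun hxy => H_adj_sigmaMap f hf hxy⟩
  have hf' : ∀ i, (f i).symm (T' i).root = (T i).root := fun i => by
    rw [← hf i]; exact (f i).symm_apply_apply _
  have := H_adj_sigmaMap (fun i => (f i).symm) hf' hxy
  have hs : ∀ z : Σ i, (T i).V, (⟨z.1, (f z.1).symm (f z.1 z.2)⟩ : Σ i, (T i).V) = z :=
    fun z => by rw [(f z.1).symm_apply_apply]
  have hx := hs x
  have hy := hs y
  rw [← hx, ← hy]
  exact this

section spider

variable {b : ℕ} (len : Fin b → ℕ)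

lemma spider_adj_none_some (q : Σ i : Fin b, Fin (len i)) :
    (spider len).graph.Adj none (some q) ↔ (q.2 : ℕ) = 0 := by
  simp [spider]

lemma spider_adj_some_none (q : Σ i : Fin b, Fin (len i)) :
    (spider len).graph.Adj (some q) none ↔ (q.2 : ℕ) = 0 := by
  simp [spider]

lemma spider_adj_some_some (p q : Σ i : Fin b, Fin (len i)) :
    (spider len).graph.Adj (some p) (some q) ↔
      p.1 = q.1 ∧ ((p.2 : ℕ) + 1 = q.2 ∨ (q.2 : ℕ) + 1 = p.2) := by
  have h : (spider len).graph.Adj (some p) (some q) ↔ some p ≠ some q ∧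
      ((p.1 = q.1 ∧ (p.2 : ℕ) + 1 = q.2) ∨ (q.1 = p.1 ∧ (q.2 : ℕ) + 1 = p.2)) := by
    simp [spider]
  rw [h]
  constructor
  · rintro ⟨-, h | h⟩
    · exact ⟨h.1, Or.inl h.2⟩
    · exact ⟨h.1.symm, Or.inr h.2⟩
  · rintro ⟨h1, h2⟩
    refine ⟨?_, ?_⟩
    · intro h3
      obtain rfl := Option.some.inj h3
      omega
    · rcases h2 with h2 | h2
      · exact Or.inl ⟨h1, h2⟩
      · exact Or.inr ⟨h1.symm, h2⟩

lemma spider_rootedIso_K₁ (hb : b = 0) : RootedIso (spider len) K₁ := by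
  subst hb
  have h : ∀ x : Option (Σ i : Fin 0, Fin (len i)), x = none := fun x => by
    cases x with
    | none => rfl
    | some q => exact q.1.elim0
  refine ⟨⟨⟨fun _ => (0 : Fin 1), fun _ => none, fun x => (h x).symm,
    fun x => Subsingleton.elim (α := Fin 1) _ _⟩, ?_⟩, rfl⟩
  intro x y
  obtain rfl := h x
  obtain rfl := h y
  exact iff_of_false (SimpleGraph.irrefl _) (SimpleGraph.irrefl _)

lemma spider_rootedIso_K₂ (hb : b = 1) (hlen : ∀ i, len i = 1) : RootedIso (spider len) K₂ := by
  subst hb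
  have h : ∀ x : Option (Σ i : Fin 1, Fin (len i)),
      x = none ∨ x = some ⟨0, ⟨0, by rw [hlen]; exact one_pos⟩⟩ := fun x => by
    cases x with
    | none => exact Or.inl rfl
    | some q =>
      right
      obtain ⟨i, j⟩ := q
      obtain rfl := Subsingleton.elim i 0
      have := j.2
      have hl := hlen 0
      congr
      omega
  refine ⟨⟨⟨fun x => (Option.elim x 0 fun _ => 1 : Fin 2), fun x : Fin 2 =>
    Fin.cases none (fun _ => some ⟨0, ⟨0, by rw [hlen]; exact one_pos⟩⟩) x,
    fun x => ?_, fun x => ?_⟩, ?_⟩, rfl⟩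
  · rcases h x with rfl | rfl
    · rfl
    · rfl
  · change Fin 2 at x
    fin_cases x
    · rfl
    · rfl
  · intro x y
    have key : ∀ p q : Fin 2, K₂.graph.Adj p q ↔ p ≠ q := fun p q => Iff.rfl
    rcases h x with rfl | rfl <;> rcases h y with rfl | rfl
    · exact iff_of_false (SimpleGraph.irrefl _) (SimpleGraph.irrefl _)
    · refine iff_of_true ((key _ _).2 (show (0 : Fin 2) ≠ 1 by decide)) ((spider_adj_none_some len _).2 rfl)
    · refine iff_of_true ((key _ _).2 (show (1 : Fin 2) ≠ 0 by decide)) ((spider_adj_some_none len _).2 rfl)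
    · exact iff_of_false (SimpleGraph.irrefl _) (SimpleGraph.irrefl _)

end spider

/-! ### Rings of spiders. -/

/-- The vertices of a cycle of length `k + 3` with a spider attached at each of its vertices. -/
abbrev RingVertex {k : ℕ} {b : ZMod (k + 3) → ℕ} (len : ∀ i, Fin (b i) → ℕ) : Type :=
  Σ i : ZMod (k + 3), Option (Σ a : Fin (b i), Fin (len i a))

section ring

variable {k : ℕ} {b : ZMod (k + 3) → ℕ} (len : ∀ i, Fin (b i) → ℕ)

/-- A cycle with a spider attached at each of its vertices. -/
def spiderRing : SimpleGraph (RingVertex len) :=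
  H (ℓ := k + 3) fun i => spider (len i)

lemma spiderRing_adj (x y : RingVertex len) : (spiderRing len).Adj x y ↔
    (∃ (i : ZMod (k + 3)) (p q : Option (Σ a : Fin (b i), Fin (len i a))),
      (spider (len i)).graph.Adj p q ∧ x = ⟨i, p⟩ ∧ y = ⟨i, q⟩) ∨
    (∃ i : ZMod (k + 3), x = ⟨i, none⟩ ∧ y = ⟨i + 1, none⟩) ∨
    ∃ i : ZMod (k + 3), y = ⟨i, none⟩ ∧ x = ⟨i + 1, none⟩ := by
  refine (H_adj _ _ _).trans (or_congr Iff.rfl ?_)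
  have h : ∀ i j : Fin (k + 3), (SimpleGraph.cycleGraph (k + 3)).Adj i j ↔ i = j + 1 ∨ j = i + 1 := by
    intro i j
    rw [SimpleGraph.cycleGraph_adj, sub_eq_iff_eq_add', sub_eq_iff_eq_add']
  constructor
  · rintro ⟨i, j, hij, h1, h2⟩
    rcases (h i j).1 hij with rfl | rfl
    · exact Or.inr ⟨j, h2, h1⟩
    · exact Or.inl ⟨i, h1, h2⟩
  · rintro (⟨i, h1, h2⟩ | ⟨i, h1, h2⟩)
    · exact ⟨i, _, (h _ _).2 (Or.inr rfl), h1, h2⟩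
    · exact ⟨_, i, (h _ _).2 (Or.inl rfl), h2, h1⟩


/-- One step towards the cycle, or along it. -/
def ringNext : RingVertex len → RingVertex len
  | ⟨i, none⟩ => ⟨i + 1, none⟩
  | ⟨i, some ⟨a, j⟩⟩ =>
    if (j : ℕ) = 0 then ⟨i, none⟩ else ⟨i, some ⟨a, ⟨j - 1, (Nat.sub_le _ _).trans_lt j.2⟩⟩⟩

/-- The distance to the cycle. -/
def ringDep : RingVertex len → ℕ
  | ⟨_, none⟩ => 0
  | ⟨_, some ⟨_, j⟩⟩ => j + 1

lemma spiderRing_adj_next (x : RingVertex len) : (spiderRing len).Adj x (ringNext len x) := by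
  refine (spiderRing_adj len _ _).2 ?_
  match x with
  | ⟨i, none⟩ => exact Or.inr (Or.inl ⟨i, rfl, rfl⟩)
  | ⟨i, some ⟨a, j⟩⟩ =>
    left
    by_cases hj : (j : ℕ) = 0
    · refine ⟨i, some ⟨a, j⟩, none, (spider_adj_some_none _ _).2 hj, rfl, ?_⟩
      simp [ringNext, hj]
    · refine ⟨i, some ⟨a, j⟩, some ⟨a, ⟨j - 1, (Nat.sub_le _ _).trans_lt j.2⟩⟩,
        (spider_adj_some_some _ _ _).2 ⟨rfl, Or.inr ?_⟩, rfl, ?_⟩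
      · change (j : ℕ) - 1 + 1 = j
        omega
      · simp [ringNext, hj]

lemma ringNext_some_zero (i : ZMod (k + 3)) (q : Σ a : Fin (b i), Fin (len i a))
    (hq : (q.2 : ℕ) = 0) : ringNext len ⟨i, some q⟩ = ⟨i, none⟩ := by
  simp [ringNext, hq]

lemma ringNext_some_succ (i : ZMod (k + 3)) (p q : Σ a : Fin (b i), Fin (len i a))
    (h : p.1 = q.1) (hq : (q.2 : ℕ) + 1 = p.2) : ringNext len ⟨i, some p⟩ = ⟨i, some q⟩ := by
  obtain ⟨a, j⟩ := p
  obtain ⟨a', j'⟩ := q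
  obtain rfl : a = a' := h
  have hj : (j : ℕ) ≠ 0 := by simp only at hq; omega
  have : (⟨j - 1, (Nat.sub_le _ _).trans_lt j.2⟩ : Fin (len i a)) = j' := by
    ext; simp only at hq ⊢; omega
  simp [ringNext, hj, this]

/-- The spider ring as a functional graph. -/
def ringForest : CycleForest (spiderRing len) k where
  next := ringNext len
  cyc i := ⟨i, none⟩
  base x := x.1
  dep := ringDep len
  base_cyc _ := rfl
  dep_cyc _ := rfl
  cyc_base x hx := by
    match x with
    | ⟨i, none⟩ => rfl
    | ⟨i, some ⟨a, j⟩⟩ => simp [ringDep] at hx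
  next_cyc _ := rfl
  dep_next x hx := by
    match x with
    | ⟨i, none⟩ => simp [ringDep] at hx
    | ⟨i, some ⟨a, j⟩⟩ =>
      by_cases hj : (j : ℕ) = 0
      · rw [ringNext_some_zero len i ⟨a, j⟩ hj]
        simp [ringDep, hj]
      · rw [ringNext_some_succ len i ⟨a, j⟩ ⟨a, ⟨j - 1, (Nat.sub_le _ _).trans_lt j.2⟩⟩ rfl
          (by simp only; omega)]
        simp only [ringDep]
        omega
  base_next x hx := by
    match x with
    | ⟨i, none⟩ => simp [ringDep] at hx
    | ⟨i, some ⟨a, j⟩⟩ =>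
      by_cases hj : (j : ℕ) = 0 <;> simp only [ringNext, hj, if_true, if_false]
  adj_iff x y := by
    constructor
    · intro h
      rcases (spiderRing_adj len _ _).1 h with ⟨i, p, q, h', rfl, rfl⟩ | ⟨i, rfl, rfl⟩ | ⟨i, rfl, rfl⟩
      · cases p with
        | none =>
          cases q with
          | none => exact absurd h' (SimpleGraph.irrefl _)
          | some q => exact Or.inr (ringNext_some_zero len i q ((spider_adj_none_some _ _).1 h'))
        | some p =>
          cases q with
          | none => exact Or.inl (ringNext_some_zero len i p ((spider_adj_some_none _ _).1 h'))
          | some q =>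
            obtain ⟨h1, h2 | h2⟩ := (spider_adj_some_some _ _ _).1 h'
            · exact Or.inr (ringNext_some_succ len i q p h1.symm h2)
            · exact Or.inl (ringNext_some_succ len i p q h1 h2)
      · exact Or.inl rfl
      · exact Or.inr rfl
    · rintro (rfl | rfl)
      · exact spiderRing_adj_next len x
      · exact (spiderRing_adj_next len y).symm

end ring

/-! ### Transport, leaves and the recognition of spider rings. -/

namespace CycleForest

variable {V V' : Type*} {G : SimpleGraph V} {G' : SimpleGraph V'} {k : ℕ} (F : CycleForest G k)

/-- Transport along a graph isomorphism. -/
def ofIso (e : G ≃g G') : CycleForest G' k where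
  next v := e (F.next (e.symm v))
  cyc i := e (F.cyc i)
  base v := F.base (e.symm v)
  dep v := F.dep (e.symm v)
  base_cyc i := by simp [F.base_cyc]
  dep_cyc i := by simp [F.dep_cyc]
  cyc_base v hv := by simp [F.cyc_base _ hv]
  next_cyc i := by simp [F.next_cyc]
  dep_next v hv := by simp [F.dep_next _ hv]
  base_next v hv := by simp [F.base_next _ hv]
  adj_iff u v := by
    rw [← e.symm.map_adj_iff, F.adj_iff]
    refine or_congr ?_ ?_
    · exact e.toEquiv.eq_symm_apply.trans Iff.rfl
    · exact e.toEquiv.eq_symm_apply.trans Iff.rfl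

/-- Renumber the cycle so that it starts with the vertex number `i₀`. -/
def rotate (i₀ : ZMod (k + 3)) : CycleForest G k where
  next := F.next
  cyc i := F.cyc (i + i₀)
  base v := F.base v - i₀
  dep := F.dep
  base_cyc i := by simp [F.base_cyc]
  dep_cyc i := by simp [F.dep_cyc]
  cyc_base v hv := by simp [F.cyc_base _ hv]
  next_cyc i := by rw [F.next_cyc]; congr 1; ring
  dep_next := F.dep_next
  base_next v hv := by rw [F.base_next v hv]
  adj_iff := F.adj_iff

/-- A vertex is a leaf if no vertex is mapped to it. -/
def IsLeaf (v : V) : Prop := ∀ u, F.next u ≠ v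

lemma IsLeaf.dep_ne_zero {F : CycleForest G k} {v : V} (h : F.IsLeaf v) : F.dep v ≠ 0 := fun h0 =>
  h (F.cyc (F.base v - 1)) (by rw [F.next_cyc, sub_add_cancel, F.cyc_base v h0])

lemma exists_isLeaf_below [Finite V] {v : V} (hv : F.dep v ≠ 0) :
    ∃ l, F.IsLeaf l ∧ F.Below l v := by
  obtain ⟨l, hl, hmax⟩ := Set.exists_max_image {u | F.Below u v} F.dep (Set.toFinite _)
    ⟨v, F.below_refl v⟩
  refine ⟨l, fun x hx => ?_, hl⟩
  have hl0 : F.dep l ≠ 0 := by have := hl.dep_le; omega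
  have hx0 : F.dep x ≠ 0 := fun hx0 => hl0 (hx ▸ F.dep_next_of_eq_zero hx0)
  have h1 := F.dep_next x hx0
  have h2 := hmax x ((hx ▸ F.below_next hx0 : F.Below x l).trans hl)
  rw [hx] at h1
  omega

/-- A map that commutes with `next` is an isomorphism. -/
def isoOfNext (F' : CycleForest G' k) (e : V ≃ V') (h : ∀ v, e (F.next v) = F'.next (e v)) :
    G ≃g G' where
  toEquiv := e
  map_rel_iff' := by
    intro u v
    rw [F.adj_iff, F'.adj_iff, ← h, ← h, e.apply_eq_iff_eq, e.apply_eq_iff_eq]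

/-- If no vertex off the cycle lies above two leaves, then the graph is a ring of spiders whose
legs correspond to the leaves. -/
lemma nonempty_iso_spiderRing [Finite V] {b : ZMod (k + 3) → ℕ}
    (e : ∀ i : ZMod (k + 3), Fin (b i) ≃ {l // F.IsLeaf l ∧ F.base l = i})
    (h : ∀ v l l', F.dep v ≠ 0 → F.IsLeaf l → F.IsLeaf l' → F.Below l v → F.Below l' v → l = l') :
    Nonempty (spiderRing (fun i a => F.dep (e i a)) ≃g G) := by
  set len : ∀ i, Fin (b i) → ℕ := fun i a => F.dep (e i a) with hlen
  -- Position `j` on a leg has depth `j + 1`, so it is reached from the leaf, of depth `dep`, by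
  -- `dep - 1 - j` steps.
  let φ : RingVertex len → V := fun x => match x with
    | ⟨i, none⟩ => F.cyc i
    | ⟨i, some ⟨a, j⟩⟩ => F.next^[F.dep (e i a) - 1 - j] (e i a)
  have φ_none : ∀ i, φ ⟨i, none⟩ = F.cyc i := fun i => rfl
  have φ_some : ∀ i a (j : Fin (len i a)),
      φ ⟨i, some ⟨a, j⟩⟩ = F.next^[F.dep (e i a) - 1 - j] (e i a) := fun i a j => rfl
  have dep_some : ∀ i a (j : Fin (len i a)), F.dep (φ ⟨i, some ⟨a, j⟩⟩) = j + 1 := by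
    intro i a j
    have hj : (j : ℕ) < F.dep (e i a) := j.2
    rw [φ_some, F.dep_iterate (by omega)]
    omega
  have below_some : ∀ i a (j : Fin (len i a)), F.Below (e i a) (φ ⟨i, some ⟨a, j⟩⟩) := by
    intro i a j
    rw [φ_some]
    exact F.below_iterate (by omega)
  have hbase : ∀ x, F.base (φ x) = x.1 := by
    rintro ⟨i, _ | ⟨a, j⟩⟩
    · exact F.base_cyc i
    · rw [← (below_some i a j).base_eq]
      exact (e i a).2.2
  have hdep : ∀ x, F.dep (φ x) = ringDep len x := by
    rintro ⟨i, _ | ⟨a, j⟩⟩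
    · exact F.dep_cyc i
    · exact dep_some i a j
  have hinj : Function.Injective φ := by
    rintro ⟨i, x⟩ ⟨i', y⟩ hxy
    obtain rfl : i = i' := by
      have := hbase ⟨i, x⟩
      rw [hxy, hbase] at this
      exact this.symm
    have hd := hdep ⟨i, x⟩
    rw [hxy, hdep] at hd
    match x, y with
    | none, none => rfl
    | none, some ⟨a, j⟩ => simp [ringDep] at hd
    | some ⟨a, j⟩, none => simp [ringDep] at hd
    | some ⟨a, j⟩, some ⟨a', j'⟩ =>
      obtain rfl : a = a' := by
        refine (e i).injective (Subtype.ext (h (φ ⟨i, some ⟨a, j⟩⟩) _ _ ?_ (e i a).2.1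
          (e i a').2.1 (below_some i a j) (hxy ▸ below_some i a' j')))
        rw [dep_some]
        omega
      simp only [ringDep] at hd
      obtain rfl : j = j' := Fin.ext (by omega)
      rfl
  have hsurj : Function.Surjective φ := by
    intro v
    by_cases hv : F.dep v = 0
    · exact ⟨⟨F.base v, none⟩, F.cyc_base v hv⟩
    · obtain ⟨l, hl, hlv⟩ := F.exists_isLeaf_below hv
      obtain ⟨a, ha⟩ := (e (F.base v)).surjective ⟨l, hl, hlv.base_eq⟩
      have ha' : (e (F.base v) a : V) = l := by rw [ha]
      have hle := hlv.dep_le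
      refine ⟨⟨F.base v, some ⟨a, ⟨F.dep v - 1, ?_⟩⟩⟩, ?_⟩
      · simp only [hlen, ha']
        omega
      · rw [φ_some]
        simp only [ha']
        rw [← hlv.2]
        congr 1
        rw [hlv.2]
        omega
  refine ⟨(ringForest len).isoOfNext F (Equiv.ofBijective φ ⟨hinj, hsurj⟩) ?_⟩
  intro x
  change φ (ringNext len x) = F.next (φ x)
  match x with
  | ⟨i, none⟩ =>
    change F.cyc (i + 1) = _
    rw [φ_none, F.next_cyc]
  | ⟨i, some ⟨a, j⟩⟩ =>
    have hj' : (j : ℕ) < F.dep (e i a) := j.2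
    by_cases hj : (j : ℕ) = 0
    · rw [ringNext_some_zero len i ⟨a, j⟩ hj, φ_none, φ_some, ← Function.iterate_succ_apply' F.next, hj,
        show (F.dep (e i a) - 1 - 0).succ = F.dep (e i a) by omega, F.iterate_dep, (e i a).2.2]
    · rw [ringNext_some_succ len i ⟨a, j⟩ ⟨a, ⟨j - 1, (Nat.sub_le _ _).trans_lt j.2⟩⟩ rfl
          (by simp only; omega), φ_some, φ_some, ← Function.iterate_succ_apply' F.next]
      congr 1
      simp only
      omega

end CycleForest

/-! ### Concave costs and layerwise summation. -/

/-- The concave majorant of `s * (n - s)` that is constant from `n / 2` on. -/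
def cutCost (n s : ℕ) : ℕ := ∑ j ∈ range s, (n - 1 - 2 * j)

lemma cutCost_mono (n : ℕ) : Monotone (cutCost n) := fun _ _ h =>
  sum_le_sum_of_subset (range_subset_range.2 h)

lemma cutCost_eq {n s : ℕ} (h : 2 * s ≤ n + 1) : cutCost n s = s * (n - s) := by
  induction s with
  | zero => simp [cutCost]
  | succ s ih =>
    rw [cutCost, sum_range_succ, ← cutCost, ih (by omega)]
    obtain ⟨d, rfl⟩ : ∃ d, n = 2 * s + 1 + d := ⟨n - (2 * s + 1), by omega⟩
    rw [show 2 * s + 1 + d - s = s + 1 + d by omega,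
      show 2 * s + 1 + d - 1 - 2 * s = d by omega,
      show 2 * s + 1 + d - (s + 1) = s + d by omega]
    ring

/-- Beyond the middle, `s * (n - s)` is its own value at `n - s`, where it agrees with the monotone
`cutCost`. -/
lemma mul_sub_le_cutCost (n s : ℕ) : s * (n - s) ≤ cutCost n s := by
  by_cases h : 2 * s ≤ n + 1
  · rw [cutCost_eq h]
  · by_cases hs : n < s
    · rw [Nat.sub_eq_zero_of_le hs.le]
      simp
    · have h1 : cutCost n (n - s) = (n - s) * (n - (n - s)) := cutCost_eq (by omega)
      rw [Nat.sub_sub_self (by omega), mul_comm] at h1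
      rw [← h1]
      exact cutCost_mono n (by omega)

lemma cutCost_lt {n s t : ℕ} (h : s < t) (ht : 2 * t ≤ n) : cutCost n s < cutCost n t := by
  refine lt_of_lt_of_le ?_ (cutCost_mono n (show s + 1 ≤ t from h))
  rw [cutCost, cutCost, sum_range_succ]
  omega

lemma cutCost_eq_sum_ite {n s m : ℕ} (h : s ≤ m) :
    cutCost n s = ∑ j ∈ range m, if j < s then n - 1 - 2 * j else 0 := by
  rw [← sum_filter, cutCost]
  congr 1
  ext j
  simp only [mem_range, mem_filter]
  omega

/-- Layer-cake summation: the increment `n - 1 - 2 * j` is paid once by every index whose value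
exceeds `j`. -/
lemma sum_cutCost {ι : Type*} (S : Finset ι) (f : ι → ℕ) {n m : ℕ} (h : ∀ i ∈ S, f i ≤ m) :
    ∑ i ∈ S, cutCost n (f i) =
      ∑ j ∈ range m, (n - 1 - 2 * j) * (S.filter fun i => j < f i).card := by
  rw [sum_congr rfl fun i hi => cutCost_eq_sum_ite (n := n) (h i hi), sum_comm]
  refine sum_congr rfl fun j _ => ?_
  rw [← sum_filter, sum_const, smul_eq_mul, mul_comm]

lemma sum_cutCost_range {n s m : ℕ} (h : s ≤ m) :
    ∑ i : Fin s, cutCost n (s - i) = ∑ j ∈ range m, (n - 1 - 2 * j) * (s - j) := by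
  rw [sum_cutCost univ (fun i : Fin s => s - (i : ℕ)) (m := m) (fun i _ => by omega)]
  refine sum_congr rfl fun j _ => ?_
  congr 1
  rw [card_filter, Fin.sum_univ_eq_sum_range (fun i => if j < s - i then 1 else 0), ← card_filter]
  conv_rhs => rw [← card_range (s - j)]
  congr 1
  ext i
  simp only [mem_filter, mem_range]
  omega

/-! ### Distances and degree parities in spider rings. -/

section ring

variable {k : ℕ} {b : ZMod (k + 3) → ℕ} (len : ∀ i, Fin (b i) → ℕ)

lemma ringNext_eq_some {u : RingVertex len} {i : ZMod (k + 3)}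
    {q : Σ a : Fin (b i), Fin (len i a)} (h : ringNext len u = ⟨i, some q⟩) :
    ∃ q' : Σ a : Fin (b i), Fin (len i a), u = ⟨i, some q'⟩ ∧ q'.1 = q.1 ∧
      (q'.2 : ℕ) = q.2 + 1 := by
  match u with
  | ⟨i', none⟩ =>
    simp [ringNext] at h
    obtain ⟨rfl, h⟩ := h
    simp at h
  | ⟨i', some ⟨a, j⟩⟩ =>
    by_cases hj : (j : ℕ) = 0
    · simp [ringNext, hj] at h
      obtain ⟨rfl, h⟩ := h
      simp at h
    · simp [ringNext, hj] at h
      obtain ⟨rfl, h⟩ := h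
      simp only [heq_eq_eq, Option.some.injEq] at h
      subst h
      exact ⟨_, rfl, rfl, by simp only; omega⟩

lemma ringNext_iterate_eq_some {m : ℕ} {u : RingVertex len} {i : ZMod (k + 3)}
    {q : Σ a : Fin (b i), Fin (len i a)} (h : (ringNext len)^[m] u = ⟨i, some q⟩) :
    ∃ q' : Σ a : Fin (b i), Fin (len i a), u = ⟨i, some q'⟩ ∧ q'.1 = q.1 ∧
      (q'.2 : ℕ) = q.2 + m := by
  induction m generalizing u with
  | zero => exact ⟨q, h, rfl, rfl⟩
  | succ m ih =>
    rw [Function.iterate_succ_apply] at h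
    obtain ⟨q', h1, h2, h3⟩ := ih h
    obtain ⟨q'', h4, h5, h6⟩ := ringNext_eq_some len h1
    exact ⟨q'', h4, h5.trans h2, by omega⟩

/-- Everything below a leg vertex lies further out on the same leg. The upper bound is enough, since
rings serve as competitors. -/
lemma size_ringForest_le (i : ZMod (k + 3)) (a : Fin (b i)) (j : Fin (len i a)) :
    (ringForest len).size ⟨i, some ⟨a, j⟩⟩ ≤ len i a - j := by
  classical
  rw [CycleForest.size, ← Nat.card_Ico]
  have key : ∀ u, (ringForest len).Below u ⟨i, some ⟨a, j⟩⟩ →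
      ∃ j' : Fin (len i a), u = ⟨i, some ⟨a, j'⟩⟩ ∧ j ≤ j' := by
    intro u hu
    obtain ⟨⟨a', j'⟩, h1, h2, h3⟩ := ringNext_iterate_eq_some len hu.2
    obtain rfl : a' = a := h2
    exact ⟨j', h1, Fin.le_def.2 (by simp only at h3; omega)⟩
  refine card_le_card_of_injOn (fun u => ringDep len u - 1) ?_ ?_
  · intro u hu
    obtain ⟨j', rfl, h⟩ := key u (by simpa using hu)
    have := Fin.le_def.1 h
    simp [ringDep]
    omega
  · intro u hu v hv huv
    obtain ⟨j', rfl, h⟩ := key u (by simpa using hu)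
    obtain ⟨j'', rfl, h'⟩ := key v (by simpa using hv)
    simp only [ringDep, add_tsub_cancel_right] at huv
    rw [Fin.ext huv]

lemma sum_offCycle_ringForest (f : RingVertex len → ℕ) :
    ∑ v ∈ (ringForest len).offCycle, f v = ∑ i, ∑ a, ∑ j, f ⟨i, some ⟨a, j⟩⟩ := by
  classical
  rw [CycleForest.offCycle, sum_filter, Fintype.sum_sigma]
  refine sum_congr rfl fun i _ => ?_
  rw [Fintype.sum_option, Fintype.sum_sigma]
  simp [ringForest, ringDep]

lemma weight_ringForest (i : ZMod (k + 3)) : (ringForest len).weight i = ∑ a, len i a := by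
  classical
  rw [CycleForest.weight, card_filter, sum_offCycle_ringForest, Fintype.sum_eq_single i]
  · refine sum_congr rfl fun a _ => ?_
    refine (sum_congr rfl fun j _ => if_pos rfl).trans ?_
    simp
  · intro i' hi'
    exact sum_eq_zero fun a _ => sum_eq_zero fun j _ => if_neg hi'

lemma card_ringVertex : Fintype.card (RingVertex len) = (k + 3) + ∑ i, ∑ a, len i a := by
  rw [← (ringForest len).card_offCycle, ← CycleForest.sum_weight, add_comm]
  simp_rw [weight_ringForest]

lemma sum_dist_spiderRing_le {n : ℕ} (hn : Fintype.card (RingVertex len) = n) :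
    ∑ u, ∑ w, (spiderRing len).dist u w ≤
      2 * ∑ j ∈ range n, (n - 1 - 2 * j) * ∑ i, ∑ a, (len i a - j) +
        (k + 3) ^ 2 / 4 * (2 * n - (k + 3)) +
        ∑ i : ZMod (k + 3), ∑ j : ZMod (k + 3),
          (∑ a, len i a) * (∑ a, len j a) * cycleNorm (i - j) := by
  classical
  rw [(ringForest len).sum_dist, hn, CycleForest.spread]
  simp_rw [weight_ringForest]
  refine Nat.add_le_add_right (Nat.add_le_add_right (Nat.mul_le_mul_left 2 ?_) _) _
  rw [sum_offCycle_ringForest]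
  have hlen : ∀ i a, len i a ≤ n := by
    intro i a
    rw [← hn, card_ringVertex]
    have h1 := single_le_sum (f := fun a => len i a) (fun _ _ => Nat.zero_le _) (mem_univ a)
    have h2 := single_le_sum (f := fun i => ∑ a, len i a) (fun _ _ => Nat.zero_le _) (mem_univ i)
    omega
  calc _ ≤ ∑ i, ∑ a, ∑ j : Fin (len i a), cutCost n (len i a - j) :=
        sum_le_sum fun i _ => sum_le_sum fun a _ => sum_le_sum fun j _ =>
          (mul_sub_le_cutCost _ _).trans (cutCost_mono n (size_ringForest_le len i a j))
    _ = ∑ i, ∑ a, ∑ j ∈ range n, (n - 1 - 2 * j) * (len i a - j) :=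
        sum_congr rfl fun i _ => sum_congr rfl fun a _ => sum_cutCost_range (hlen i a)
    _ = _ := by
        simp_rw [mul_sum]
        rw [sum_congr rfl fun i _ => sum_comm, sum_comm]

lemma card_ringNext_eq_none (hlen : ∀ i a, 1 ≤ len i a) (i : ZMod (k + 3))
    [DecidablePred fun u => ringNext len u = ⟨i, none⟩] :
    (univ.filter fun u => ringNext len u = ⟨i, none⟩).card = b i + 1 := by
  classical
  let ι : Fin (b i) → RingVertex len := fun a => ⟨i, some ⟨a, ⟨0, hlen i a⟩⟩⟩
  have hι : Function.Injective ι := by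
    intro a a' h
    simp [ι] at h
    exact h.1
  have : (univ.filter fun u => ringNext len u = ⟨i, none⟩) =
      insert ⟨i - 1, none⟩ (univ.image ι) := by
    ext u
    simp only [mem_filter, mem_univ, true_and, mem_insert, mem_image]
    constructor
    · intro h
      match u with
      | ⟨i', none⟩ =>
        left
        have : i' + 1 = i := congrArg Sigma.fst h
        rw [← this, add_sub_cancel_right]
      | ⟨i', some ⟨a, j⟩⟩ =>
        right
        by_cases hj : (j : ℕ) = 0
        · rw [ringNext_some_zero len i' ⟨a, j⟩ hj] at h
          obtain rfl : i' = i := congrArg Sigma.fst h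
          refine ⟨a, ?_⟩
          simp only [ι]
          rw [show (⟨0, hlen i' a⟩ : Fin (len i' a)) = j from Fin.ext hj.symm]
        · simp [ringNext, hj] at h
          obtain ⟨rfl, h⟩ := h
          simp at h
    · rintro (rfl | ⟨a, rfl⟩)
      · exact congrArg (fun t => (⟨t, none⟩ : RingVertex len)) (sub_add_cancel i 1)
      · simp [ringNext, ι]
  rw [this, card_insert_of_notMem, card_image_of_injective _ hι, card_univ, Fintype.card_fin]
  simp only [mem_image, mem_univ, true_and, not_exists, ι]
  intro a h
  have h1 := congrArg (ringDep len) h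
  simp [ringDep] at h1

lemma card_ringNext_eq_some (i : ZMod (k + 3)) (a : Fin (b i)) (j : Fin (len i a))
    [DecidablePred fun u => ringNext len u = ⟨i, some ⟨a, j⟩⟩] :
    (univ.filter fun u => ringNext len u = ⟨i, some ⟨a, j⟩⟩).card =
      if (j : ℕ) + 1 < len i a then 1 else 0 := by
  classical
  split_ifs with h
  · rw [card_eq_one]
    refine ⟨⟨i, some ⟨a, ⟨j + 1, h⟩⟩⟩, ?_⟩
    ext u
    simp only [mem_filter, mem_univ, true_and, mem_singleton]
    constructor
    · intro hu
      obtain ⟨⟨a', j'⟩, rfl, h2, h3⟩ := ringNext_eq_some len hu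
      obtain rfl : a' = a := h2
      rw [show j' = (⟨j + 1, h⟩ : Fin (len i a')) from Fin.ext h3]
    · rintro rfl
      exact ringNext_some_succ len i _ _ rfl rfl
  · rw [card_eq_zero]
    ext u
    simp only [mem_filter, mem_univ, true_and, notMem_empty, iff_false]
    intro hu
    obtain ⟨⟨a', j'⟩, rfl, h2, h3⟩ := ringNext_eq_some len hu
    obtain rfl : a' = a := h2
    have := j'.2
    simp only at h3
    omega

/-- A centre has degree `b i + 2`, an inner vertex of a leg has degree two, the tip of a leg degree
one. -/
lemma evenDegreeCount_spiderRing (hlen : ∀ i a, 1 ≤ len i a) :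
    evenDegreeCount (spiderRing len) =
      ∑ i, ((if Even (b i) then 1 else 0) + ∑ a, (len i a - 1)) := by
  classical
  rw [evenDegreeCount, card_filter, Fintype.sum_sigma]
  refine sum_congr rfl fun i _ => ?_
  rw [Fintype.sum_option, Fintype.sum_sigma]
  congr 1
  · refine if_congr ?_ rfl rfl
    rw [(ringForest len).degree_eq]
    have := card_ringNext_eq_none len hlen i
    rw [show (univ.filter fun u => (ringForest len).next u = ⟨i, none⟩).card = b i + 1 from this]
    simp [Nat.even_add_one]
  · refine sum_congr rfl fun a _ => ?_
    have h1 : ∀ j : Fin (len i a), (if Even ((spiderRing len).degree ⟨i, some ⟨a, j⟩⟩) then 1 else 0)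
        = if (j : ℕ) < len i a - 1 then 1 else 0 := by
      intro j
      refine if_congr ?_ rfl rfl
      rw [(ringForest len).degree_eq]
      have := card_ringNext_eq_some len i a j
      rw [show (univ.filter fun u => (ringForest len).next u = ⟨i, some ⟨a, j⟩⟩).card = _ from this]
      split_ifs with h
      · exact iff_of_true (by decide) (by omega)
      · exact iff_of_false (by decide) (by omega)
    rw [sum_congr rfl fun j _ => h1 j, Fin.sum_univ_eq_sum_range (fun j => if j < len i a - 1 then 1 else 0),
      ← card_filter]
    rw [← card_range (len i a - 1)]
    congr 1
    ext j
    simp only [mem_filter, mem_range, card_range]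
    omega

end ring

/-! ### Copies of competitors on a prescribed vertex set. -/

section transport

variable {V W : Type*} [Fintype V] [Fintype W] {G : SimpleGraph V} {G' : SimpleGraph W}

omit [Fintype V] [Fintype W] in
lemma dist_apply_le (hG : G.Connected) (e : G ≃g G') (u v : V) :
    G'.dist (e u) (e v) ≤ G.dist u v := by
  obtain ⟨p, hp⟩ := hG.exists_walk_length_eq_dist u v
  rw [← hp, ← SimpleGraph.Walk.length_map e.toHom p]
  exact SimpleGraph.dist_le _

lemma evenDegreeCount_congr (e : G ≃g G') : evenDegreeCount G' = evenDegreeCount G := by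
  classical
  unfold evenDegreeCount
  refine (card_bij (fun v _ => e v) ?_ ?_ ?_).symm
  · intro v hv
    simpa using hv
  · intro u _ v _ h
    exact e.injective h
  · intro w hw
    refine ⟨e.symm w, ?_, e.apply_symm_apply w⟩
    rw [mem_filter] at hw ⊢
    refine ⟨mem_univ _, ?_⟩
    rw [← SimpleGraph.Iso.degree_eq e, e.apply_symm_apply]
    exact hw.2

/-- Every graph with a functional description has a copy in the family on `V`. -/
lemma CycleForest.exists_mem_unicyclicFamily {k : ℕ} (F : CycleForest G k)
    (h : Fintype.card W = Fintype.card V) :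
    ∃ G' ∈ unicyclicFamily W (evenDegreeCount G),
      ∑ u, ∑ w, G'.dist u w ≤ ∑ u, ∑ w, G.dist u w := by
  classical
  obtain ⟨e⟩ : Nonempty (V ≃ W) := Fintype.card_eq.1 h.symm
  let φ : G ≃g G.map e.toEmbedding := SimpleGraph.Iso.map e G
  refine ⟨_, ⟨(F.ofIso φ).isUnicyclic, evenDegreeCount_congr φ⟩, ?_⟩
  calc _ = ∑ u, ∑ w, (G.map e.toEmbedding).dist (φ u) (φ w) := by
        rw [← Equiv.sum_comp e]
        exact sum_congr rfl fun u _ => (Equiv.sum_comp e _).symm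
    _ ≤ _ := sum_le_sum fun u _ => sum_le_sum fun w _ => dist_apply_le F.connected φ u w

end transport

/-! ### Leaves and heights. -/

namespace CycleForest

variable {V : Type*} {G : SimpleGraph V} {k : ℕ} (F : CycleForest G k) [Fintype V]

open scoped Classical in
/-- The leaves. -/
noncomputable def leaves : Finset V := univ.filter F.IsLeaf

lemma mem_leaves {v : V} : v ∈ F.leaves ↔ F.IsLeaf v := by simp [leaves]

/-- A leaf has degree one, so no leaf is counted by `evenDegreeCount`. -/
lemma card_leaves_add_le : F.leaves.card + evenDegreeCount G ≤ Fintype.card V := by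
  classical
  unfold evenDegreeCount
  rw [← card_union_of_disjoint]
  · exact card_le_univ _
  · rw [disjoint_left]
    intro v hv hv'
    rw [mem_leaves] at hv
    have h := (mem_filter.1 hv').2
    rw [F.degree_eq, filter_eq_empty_iff.2 fun u _ => hv u] at h
    simp at h

lemma exists_leaf_below (v : V) : ∃ l, F.dep v ≠ 0 → F.IsLeaf l ∧ F.Below l v := by
  by_cases hv : F.dep v = 0
  · exact ⟨v, fun h => absurd hv h⟩
  · obtain ⟨l, hl⟩ := F.exists_isLeaf_below hv
    exact ⟨l, fun _ => hl⟩

/-- A leaf below `v`, if `v` is off the cycle. -/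
noncomputable def leafBelow (v : V) : V := (F.exists_leaf_below v).choose

lemma isLeaf_leafBelow {v : V} (hv : F.dep v ≠ 0) : F.IsLeaf (F.leafBelow v) :=
  ((F.exists_leaf_below v).choose_spec hv).1

lemma leafBelow_below {v : V} (hv : F.dep v ≠ 0) : F.Below (F.leafBelow v) v :=
  ((F.exists_leaf_below v).choose_spec hv).2

/-- The number of vertices on the path from the chosen leaf below `v` to `v`. -/
noncomputable def height (v : V) : ℕ := F.dep (F.leafBelow v) - F.dep v + 1

open scoped Classical in
/-- The path from the chosen leaf below `v` to `v`. -/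
noncomputable def leafPath (v : V) : Finset V :=
  (range (F.height v)).image fun i => F.next^[i] (F.leafBelow v)

lemma card_leafPath {v : V} (hv : F.dep v ≠ 0) : (F.leafPath v).card = F.height v := by
  classical
  have h := (F.leafBelow_below hv).dep_le
  rw [leafPath, card_image_of_injOn, card_range]
  intro i hi j hj hij
  simp only [coe_range, Set.mem_Iio, height] at hi hj
  have := congrArg F.dep hij
  simp only at this
  rw [F.dep_iterate (by omega), F.dep_iterate (by omega)] at this
  omega

lemma leafPath_subset {v : V} (hv : F.dep v ≠ 0) [DecidablePred fun u => F.Below u v] :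
    F.leafPath v ⊆ univ.filter fun u => F.Below u v := by
  classical
  have h := F.leafBelow_below hv
  intro u hu
  obtain ⟨i, hi, rfl⟩ := mem_image.1 hu
  simp only [height, mem_range] at hi
  have hle := h.dep_le
  rw [mem_filter]
  have hd := F.dep_iterate (v := F.leafBelow v) (j := i) (by omega)
  exact ⟨mem_univ _, F.below_of_below (F.below_iterate (by omega)) h (by omega)⟩

lemma height_le_size {v : V} (hv : F.dep v ≠ 0) : F.height v ≤ F.size v := by
  classical
  rw [← F.card_leafPath hv, size]
  exact card_le_card (F.leafPath_subset hv)

omit [Fintype V] in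
lemma IsLeaf.eq_of_below {F : CycleForest G k} {u l : V} (hl : F.IsLeaf l) (h : F.Below u l) :
    u = l := by
  by_contra hne
  have h1 := h.2
  have h2 : F.dep u - F.dep l ≠ 0 := fun h0 => hne (by rwa [h0] at h1)
  obtain ⟨m, hm⟩ := Nat.exists_eq_succ_of_ne_zero h2
  rw [hm, Function.iterate_succ_apply'] at h1
  exact hl _ h1

lemma IsLeaf.size_eq {F : CycleForest G k} {l : V} (hl : F.IsLeaf l) : F.size l = 1 := by
  classical
  rw [size, card_eq_one]
  refine ⟨l, ?_⟩
  ext u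
  simp only [mem_filter, mem_univ, true_and, mem_singleton]
  exact ⟨hl.eq_of_below, fun h => h ▸ F.below_refl u⟩

/-- If the subtree of `v` has only `height v` vertices, then it contains only one leaf. -/
lemma eq_leafBelow {v l : V} (hv : F.dep v ≠ 0) (h : F.size v ≤ F.height v) (hl : F.IsLeaf l)
    (hlv : F.Below l v) : l = F.leafBelow v := by
  classical
  have h1 : F.leafPath v = univ.filter fun u => F.Below u v :=
    eq_of_subset_of_card_le (F.leafPath_subset hv) (by
      rw [F.card_leafPath hv]
      exact h)
  have h2 : l ∈ F.leafPath v := by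
    rw [h1]
    simpa using hlv
  obtain ⟨i, -, hi⟩ := mem_image.1 h2
  cases i with
  | zero => exact hi.symm
  | succ i =>
    rw [Function.iterate_succ_apply'] at hi
    exact absurd hi (hl _)

lemma card_image_leafIndex [DecidableEq V] {S : Finset V} (hS : ∀ v ∈ S, F.dep v ≠ 0) {j : ℕ} :
    ((S.filter fun v => F.height v ≤ j).image fun v =>
      (F.leafBelow v, F.dep (F.leafBelow v) - F.dep v)).card =
      (S.filter fun v => F.height v ≤ j).card := by
  refine card_image_of_injOn ?_
  intro u hu v hv huv
  have hu0 := hS u (mem_filter.1 (mem_coe.1 hu)).1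
  have hv0 := hS v (mem_filter.1 (mem_coe.1 hv)).1
  simp only [Prod.mk.injEq] at huv
  have h1 := (F.leafBelow_below hu0).2
  have h2 := (F.leafBelow_below hv0).2
  rw [huv.2, huv.1] at h1
  exact h1.symm.trans h2

lemma image_leafIndex_subset [DecidableEq V] {S : Finset V} (hS : ∀ v ∈ S, F.dep v ≠ 0) (j : ℕ) :
    ((S.filter fun v => F.height v ≤ j).image fun v =>
      (F.leafBelow v, F.dep (F.leafBelow v) - F.dep v)) ⊆ F.leaves ×ˢ range j := by
  intro p hp
  obtain ⟨v, hv, rfl⟩ := mem_image.1 hp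
  obtain ⟨hv1, hv2⟩ := mem_filter.1 hv
  have h0 := hS v hv1
  simp only [height] at hv2
  rw [mem_product, mem_leaves, mem_range]
  exact ⟨F.isLeaf_leafBelow h0, by simp only; omega⟩

/-- A vertex is recovered from its chosen leaf and its distance to that leaf, so each leaf accounts
for at most `j` vertices of height at most `j`. -/
lemma card_filter_height_le {S : Finset V} (hS : ∀ v ∈ S, F.dep v ≠ 0) (j : ℕ) :
    (S.filter fun v => F.height v ≤ j).card ≤ F.leaves.card * j := by
  classical
  rw [← F.card_image_leafIndex hS, ← card_range j, ← card_product, card_range]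
  exact card_le_card (F.image_leafIndex_subset hS j)

/-- A leaf of depth less than `j` has no ancestor off the cycle at `j - 1` steps, so the pair `(l, j
- 1)` is missed. This detects legs that are too short. -/
lemma card_filter_height_le_of_dep_lt {S : Finset V} (hS : ∀ v ∈ S, F.dep v ≠ 0) {j : ℕ} {l : V}
    (hl : F.IsLeaf l) (hlj : F.dep l < j) :
    (S.filter fun v => F.height v ≤ j).card < F.leaves.card * j := by
  classical
  rw [← F.card_image_leafIndex hS, ← card_range j, ← card_product, card_range]
  refine card_lt_card ((ssubset_iff_of_subset (F.image_leafIndex_subset hS j)).2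
    ⟨(l, j - 1), ?_, fun h => ?_⟩)
  · rw [mem_product, mem_leaves, mem_range]
    exact ⟨hl, by simp only; omega⟩
  · obtain ⟨v, hv, hvl⟩ := mem_image.1 h
    have h0 := hS v (mem_filter.1 hv).1
    simp only [Prod.mk.injEq] at hvl
    rw [hvl.1] at hvl
    have := hl.dep_ne_zero
    omega

lemma sub_le_card_filter_height {S : Finset V} (hS : ∀ v ∈ S, F.dep v ≠ 0) {b : ℕ}
    (hb : F.leaves.card ≤ b) (j : ℕ) :
    S.card - b * j ≤ (S.filter fun v => j < F.height v).card := by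
  have h1 := F.card_filter_height_le hS j
  have h2 := card_filter_add_card_filter_not (s := S) fun v => F.height v ≤ j
  have h3 : (S.filter fun v => ¬ F.height v ≤ j) = S.filter fun v => j < F.height v :=
    filter_congr fun v _ => not_le
  rw [h3] at h2
  have h4 := Nat.mul_le_mul_right j hb
  omega

/-! ### Light vertices: the lower bound and its equality case. -/

open scoped Classical in
/-- The vertices whose subtree contains more than half of all vertices. -/
noncomputable def heavy : Finset V := F.offCycle.filter fun v => Fintype.card V < 2 * F.size v

open scoped Classical in
/-- The vertices off the cycle whose subtree contains at most half of all vertices. -/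
noncomputable def light : Finset V := F.offCycle.filter fun v => ¬ Fintype.card V < 2 * F.size v

lemma mem_heavy {v : V} : v ∈ F.heavy ↔ F.dep v ≠ 0 ∧ Fintype.card V < 2 * F.size v := by
  simp [heavy, mem_offCycle]

lemma mem_light {v : V} : v ∈ F.light ↔ F.dep v ≠ 0 ∧ 2 * F.size v ≤ Fintype.card V := by
  simp [light, mem_offCycle]

lemma sum_heavy_add_sum_light (f : V → ℕ) :
    ∑ v ∈ F.heavy, f v + ∑ v ∈ F.light, f v = ∑ v ∈ F.offCycle, f v :=
  sum_filter_add_sum_filter_not _ _ _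

lemma card_heavy_add_card_light : F.heavy.card + F.light.card = F.offCycle.card := by
  classical
  exact card_filter_add_card_filter_not _

lemma size_light_le {v : V} (hv : v ∈ F.light) : F.height v ≤ F.size v :=
  F.height_le_size (F.mem_light.1 hv).1

lemma sum_light_eq : ∑ v ∈ F.light, F.size v * (Fintype.card V - F.size v) =
    ∑ v ∈ F.light, cutCost (Fintype.card V) (F.size v) :=
  sum_congr rfl fun v hv => (cutCost_eq (by have := (F.mem_light.1 hv).2; omega)).symm

lemma sum_cutCost_height : ∑ v ∈ F.light, cutCost (Fintype.card V) (F.height v) =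
    ∑ j ∈ range (Fintype.card V), (Fintype.card V - 1 - 2 * j) *
      (F.light.filter fun v => j < F.height v).card :=
  sum_cutCost _ _ fun _ hv => (F.size_light_le hv).trans (F.size_le_card _)

lemma sum_cutCost_height_le : ∑ v ∈ F.light, cutCost (Fintype.card V) (F.height v) ≤
    ∑ v ∈ F.light, F.size v * (Fintype.card V - F.size v) := by
  rw [sum_light_eq]
  exact sum_le_sum fun v hv => cutCost_mono _ (F.size_light_le hv)

lemma le_sum_cutCost_height {b : ℕ} (hb : F.leaves.card ≤ b) :
    ∑ j ∈ range (Fintype.card V), (Fintype.card V - 1 - 2 * j) * (F.light.card - b * j) ≤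
      ∑ v ∈ F.light, cutCost (Fintype.card V) (F.height v) := by
  rw [sum_cutCost_height]
  exact sum_le_sum fun j _ => Nat.mul_le_mul_left _
    (F.sub_le_card_filter_height (fun v hv => (F.mem_light.1 hv).1) hb j)

/-- The case of equality in the lower bound for the contribution of the light vertices. -/
lemma size_eq_height_of_sum_le {b : ℕ} (hb : F.leaves.card ≤ b)
    (h : ∑ v ∈ F.light, F.size v * (Fintype.card V - F.size v) ≤
      ∑ j ∈ range (Fintype.card V), (Fintype.card V - 1 - 2 * j) * (F.light.card - b * j)) :
    (∀ v ∈ F.light, F.size v = F.height v) ∧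
      ∀ j, (F.light.filter fun v => j < F.height v).card ≤ F.light.card - b * j := by
  have h1 := F.sum_cutCost_height_le
  have h2 := F.le_sum_cutCost_height hb
  constructor
  · by_contra! hne
    obtain ⟨v, hv, hne⟩ := hne
    have h3 : ∑ v ∈ F.light, cutCost (Fintype.card V) (F.height v) <
        ∑ v ∈ F.light, cutCost (Fintype.card V) (F.size v) :=
      sum_lt_sum (fun v hv => cutCost_mono _ (F.size_light_le hv))
        ⟨v, hv, cutCost_lt (lt_of_le_of_ne (F.size_light_le hv) hne.symm) (F.mem_light.1 hv).2⟩
    rw [← sum_light_eq] at h3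
    omega
  · by_contra! hlt
    obtain ⟨j, hj⟩ := hlt
    obtain ⟨v, hv⟩ := card_pos.1 (show 0 < (F.light.filter fun v => j < F.height v).card by omega)
    obtain ⟨hv, hjv⟩ := mem_filter.1 hv
    have hv1 := F.size_light_le hv
    have hv2 := (F.mem_light.1 hv).2
    -- Since `j` is below the height of a light vertex, which is at most half of all vertices, layer
    -- `j` has a positive coefficient and a surplus there is strict.
    have h3 : ∑ j ∈ range (Fintype.card V), (Fintype.card V - 1 - 2 * j) *
          (F.light.card - b * j) < ∑ v ∈ F.light, cutCost (Fintype.card V) (F.height v) := by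
      rw [sum_cutCost_height]
      refine sum_lt_sum (fun j _ => Nat.mul_le_mul_left _
        (F.sub_le_card_filter_height (fun v hv => (F.mem_light.1 hv).1) hb j))
        ⟨j, mem_range.2 (by omega), Nat.mul_lt_mul_of_pos_left hj (by omega)⟩
    omega

end CycleForest

/-! ### Heavy vertices and the lengthening of the cycle. -/

lemma eq_range_card {A : Finset ℕ} (h : ∀ x ∈ A, ∀ y < x, y ∈ A) : A = range A.card := by
  refine eq_of_subset_of_card_le (fun x hx => ?_) (by simp)
  rw [mem_range]
  have : range (x + 1) ⊆ A := fun y hy => by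
    rcases Nat.lt_succ_iff_lt_or_eq.1 (mem_range.1 hy) with hy | rfl
    · exact h x hx y hy
    · exact hx
  simpa using card_le_card this

/-- Twice the contribution of a cycle of length `g` in a graph on `n` vertices. -/
def cycleCost (n g : ℕ) : ℕ := g ^ 2 / 4 * (2 * n - g)

lemma sq_div_four_add (g : ℕ) : (g + 1) ^ 2 / 4 = g ^ 2 / 4 + (g + 1) / 2 := by
  obtain ⟨h, rfl | rfl⟩ := Nat.even_or_odd' g
  · rw [show (2 * h + 1) ^ 2 = 1 + 4 * (h ^ 2 + h) by ring, show (2 * h) ^ 2 = 4 * h ^ 2 by ring]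
    omega
  · rw [show (2 * h + 1 + 1) ^ 2 = 4 * (h ^ 2 + 2 * h + 1) by ring,
      show (2 * h + 1) ^ 2 = 1 + 4 * (h ^ 2 + h) by ring]
    omega

/-- Replacing a cut edge with `g` vertices on one side by one more vertex of the cycle saves cost,
as long as these are fewer than half of all vertices. -/
lemma cycleCost_succ_lt {n g : ℕ} (hg : 3 ≤ g) (h : 2 * g < n) :
    cycleCost n (g + 1) < 2 * (g * (n - g)) + cycleCost n g := by
  unfold cycleCost
  rw [sq_div_four_add]
  obtain ⟨d, rfl⟩ : ∃ d, n = 2 * g + 1 + d := ⟨n - (2 * g + 1), by omega⟩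
  rw [show 2 * (2 * g + 1 + d) - (g + 1) = 3 * g + 1 + 2 * d by omega,
    show 2 * (2 * g + 1 + d) - g = 3 * g + 2 + 2 * d by omega,
    show 2 * g + 1 + d - g = g + 1 + d by omega]
  have h1 : 2 * ((g + 1) / 2) ≤ g + 1 := by omega
  nlinarith [Nat.zero_le (g ^ 2 / 4), Nat.mul_le_mul_right (3 * g + 1 + 2 * d) h1]

lemma cycleCost_add_le {n g : ℕ} (hg : 3 ≤ g) (m : ℕ) (h : ∀ d < m, 2 * (g + d) < n) :
    cycleCost n (g + m) + m ≤ ∑ d ∈ range m, 2 * ((g + d) * (n - (g + d))) + cycleCost n g := by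
  induction m with
  | zero => simp
  | succ m ih =>
    have h1 := ih fun d hd => h d (by omega)
    have h2 := cycleCost_succ_lt (n := n) (g := g + m) (by omega) (h m (by omega))
    rw [sum_range_succ, ← add_assoc g m 1]
    omega

namespace CycleForest

variable {V : Type*} {G : SimpleGraph V} {k : ℕ} (F : CycleForest G k) [Fintype V]

lemma Below.size_le {F : CycleForest G k} {u v : V} (h : F.Below u v) : F.size u ≤ F.size v := by
  classical
  refine card_le_card fun w hw => ?_
  rw [mem_filter] at hw ⊢
  exact ⟨hw.1, hw.2.trans h⟩

lemma size_lt_size_next {v : V} (hv : F.dep v ≠ 0) : F.size v < F.size (F.next v) := by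
  classical
  refine card_lt_card ((ssubset_iff_of_subset fun w hw => ?_).2 ⟨F.next v, ?_, ?_⟩)
  · rw [mem_filter] at hw ⊢
    exact ⟨hw.1, hw.2.trans (F.below_next hv)⟩
  · simpa using F.below_refl _
  · simp only [mem_filter, mem_univ, true_and]
    intro h
    have h1 := h.dep_le
    have h2 := F.dep_next v hv
    omega

lemma one_le_size (v : V) : 1 ≤ F.size v :=
  card_pos.2 ⟨v, by simpa using F.below_refl v⟩

/-- The cycle and the `dep v - 1` proper ancestors of `v` off the cycle lie outside its subtree. -/
lemma size_add_dep_le {v : V} (hv : F.dep v ≠ 0) :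
    F.size v + F.dep v + (k + 3) ≤ Fintype.card V + 1 := by
  classical
  induction hd : F.dep v using Nat.strong_induction_on generalizing v with
  | _ d ih =>
    have h1 := F.dep_next v hv
    by_cases h0 : F.dep (F.next v) = 0
    · have h2 : F.size v ≤ F.offCycle.card := card_le_card fun u hu => by
        rw [mem_offCycle]
        have := (mem_filter.1 hu).2.dep_le
        omega
      have := F.card_offCycle
      omega
    · have h2 := ih _ (by omega) h0 rfl
      have h3 := F.size_lt_size_next hv
      omega

/-- Two subtrees with more than half of all vertices intersect, so their roots are comparable. -/
lemma dep_injOn_heavy {u v : V} (hu : u ∈ F.heavy) (hv : v ∈ F.heavy) (h : F.dep u = F.dep v) :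
    u = v := by
  classical
  have hu2 := (F.mem_heavy.1 hu).2
  have hv2 := (F.mem_heavy.1 hv).2
  have : ¬ Disjoint (univ.filter fun w => F.Below w u) (univ.filter fun w => F.Below w v) := by
    intro hd
    have h1 := card_union_of_disjoint hd
    have h2 := card_le_univ ((univ.filter fun w => F.Below w u) ∪ univ.filter fun w => F.Below w v)
    unfold size at hu2 hv2
    omega
  rw [not_disjoint_iff] at this
  obtain ⟨w, hw1, hw2⟩ := this
  rw [mem_filter] at hw1 hw2
  exact (F.below_of_below hw1.2 hw2.2 h.ge).eq_of_dep_le h.le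

/-- Ancestors of a heavy vertex off the cycle are heavy, so the heavy vertices form a path whose
depths start at one without gaps. -/
lemma image_dep_heavy :
    F.heavy.image (fun v => F.dep v - 1) = range F.heavy.card := by
  have hinj : Set.InjOn (fun v => F.dep v - 1) F.heavy := by
    intro u hu v hv huv
    have hu1 := (F.mem_heavy.1 hu).1
    have hv1 := (F.mem_heavy.1 hv).1
    simp only at huv
    exact F.dep_injOn_heavy hu hv (by omega)
  rw [← card_image_of_injOn hinj]
  refine eq_range_card fun x hx y hy => ?_
  obtain ⟨v, hv, rfl⟩ := mem_image.1 hx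
  obtain ⟨hv1, hv2⟩ := F.mem_heavy.1 hv
  have h1 := F.dep_iterate (v := v) (j := F.dep v - 1 - y) (by omega)
  have h2 := (F.below_iterate (u := v) (j := F.dep v - 1 - y) (by omega)).size_le
  exact mem_image.2 ⟨F.next^[F.dep v - 1 - y] v, F.mem_heavy.2 ⟨by omega, by omega⟩, by omega⟩

/-- A heavy vertex of depth `d + 1` has at least `g + d` vertices outside its subtree, yet fewer
than half of all. So its cut edge costs at least what pays for growing the cycle from `g + d` to `g
+ d + 1`. The summand `heavy.card` on the left records the strictness of each step. -/
lemma le_sum_heavy :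
    cycleCost (Fintype.card V) (k + 3 + F.heavy.card) + F.heavy.card ≤
      2 * ∑ v ∈ F.heavy, F.size v * (Fintype.card V - F.size v) +
        cycleCost (Fintype.card V) (k + 3) := by
  have hb : ∀ v ∈ F.heavy, k + 3 + (F.dep v - 1) ≤ Fintype.card V - F.size v ∧
      2 * (Fintype.card V - F.size v) < Fintype.card V := by
    intro v hv
    obtain ⟨hv1, hv2⟩ := F.mem_heavy.1 hv
    have h1 := F.size_add_dep_le hv1
    have h2 := F.size_le_card v
    omega
  refine (cycleCost_add_le (by omega) _ fun d hd => ?_).trans (Nat.add_le_add_right ?_ _)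
  · rw [← mem_range, ← F.image_dep_heavy] at hd
    obtain ⟨v, hv, rfl⟩ := mem_image.1 hd
    have := hb v hv
    omega
  · rw [← F.image_dep_heavy, sum_image, mul_sum]
    · refine sum_le_sum fun v hv => Nat.mul_le_mul_left 2 ?_
      obtain ⟨h1, h2⟩ := hb v hv
      have h3 := F.size_le_card v
      have h4 : cutCost (Fintype.card V) (Fintype.card V - F.size v) = _ := cutCost_eq (by omega)
      rw [Nat.sub_sub_self h3, mul_comm] at h4
      rw [← h4, ← cutCost_eq (by omega)]
      exact cutCost_mono _ h1
    · intro u hu v hv huv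
      have hu1 := (F.mem_heavy.1 hu).1
      have hv1 := (F.mem_heavy.1 hv).1
      simp only at huv
      exact F.dep_injOn_heavy hu hv (by omega)

/-- The lower bound for the Wiener index in terms of the number of heavy vertices. -/
lemma le_sum_dist :
    2 * ∑ v ∈ F.light, F.size v * (Fintype.card V - F.size v) +
      cycleCost (Fintype.card V) (k + 3 + F.heavy.card) + F.heavy.card + F.spread ≤
      ∑ u, ∑ w, G.dist u w := by
  rw [F.sum_dist, ← sum_heavy_add_sum_light]
  have := F.le_sum_heavy
  unfold cycleCost at this ⊢
  omega

lemma card_light_add : k + 3 + F.heavy.card + F.light.card = Fintype.card V := by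
  have h1 := F.card_offCycle
  have h2 := F.card_heavy_add_card_light
  omega

lemma light_nonempty (h : F.offCycle.Nonempty) : F.light.Nonempty := by
  obtain ⟨v, hv⟩ := h
  obtain ⟨l, hl, -⟩ := F.exists_isLeaf_below (F.mem_offCycle.1 hv)
  have h1 := F.card_offCycle
  exact ⟨l, F.mem_light.2 ⟨hl.dep_ne_zero, by rw [hl.size_eq]; omega⟩⟩

lemma eq_cyc_of_weight_eq_zero {u : V} {i : ZMod (k + 3)} (hi : F.weight i = 0)
    (h : F.base u = i) : u = F.cyc i := by
  have h0 : F.dep u = 0 := by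
    by_contra h0
    refine absurd hi (card_pos.2 ⟨u, mem_filter.2 ⟨F.mem_offCycle.2 h0, h⟩⟩).ne'
  rw [← h, F.cyc_base u h0]

/-- With no branch attached, the cycle vertex has only its two neighbours on the cycle. -/
lemma even_degree_cyc {i : ZMod (k + 3)} (hi : F.weight i = 0)
    [Fintype (G.neighborSet (F.cyc i))] : Even (G.degree (F.cyc i)) := by
  classical
  rw [F.degree_eq]
  have : (univ.filter fun u => F.next u = F.cyc i) = {F.cyc (i - 1)} := by
    ext u
    simp only [mem_filter, mem_univ, true_and, mem_singleton]
    constructor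
    · intro h
      by_cases h0 : F.dep u = 0
      · rw [← F.cyc_base u h0, F.next_cyc] at h
        rw [← F.cyc_injective h, add_sub_cancel_right, F.cyc_base u h0]
      · have h1 := F.base_next u h0
        rw [h, F.base_cyc] at h1
        have h2 := F.eq_cyc_of_weight_eq_zero hi h1.symm
        exact absurd (h2 ▸ F.dep_cyc i) h0
    · rintro rfl
      rw [F.next_cyc, sub_add_cancel]
  rw [this, card_singleton]
  decide

lemma card_weight_eq_zero_le [DecidablePred fun i => F.weight i = 0] :
    (univ.filter fun i => F.weight i = 0).card ≤ evenDegreeCount G := by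
  classical
  refine card_le_card_of_injOn F.cyc (fun i hi => ?_) F.cyc_injective.injOn
  rw [mem_coe, mem_filter] at hi ⊢
  exact ⟨mem_univ _, F.even_degree_cyc hi.2⟩

end CycleForest

/-! ### The cost of a cycle with pendant edges at one vertex. -/

/-- Twice the Wiener index of a cycle of length `g` with `n - g` leaves at one vertex. -/
def starCost (n g : ℕ) : ℕ := 2 * ((n - 1) * (n - g)) + cycleCost n g

lemma starCost_succ {n g : ℕ} (h : g + 2 ≤ n) :
    starCost n (g + 1) + g ^ 2 / 4 + 2 * (n - 1) =
      starCost n g + (g + 1) / 2 * (2 * n - (g + 1)) := by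
  unfold starCost cycleCost
  rw [sq_div_four_add]
  obtain ⟨d, rfl⟩ : ∃ d, n = g + 2 + d := ⟨n - (g + 2), by omega⟩
  rw [show g + 2 + d - (g + 1) = d + 1 by omega, show g + 2 + d - g = d + 2 by omega,
    show 2 * (g + 2 + d) - (g + 1) = g + 3 + 2 * d by omega,
    show 2 * (g + 2 + d) - g = g + 3 + 2 * d + 1 by omega]
  ring

/-- With `n = g + 2 + d`, the increment is `(j - 2)(j + 1) + 2 d (j - 1)` for `g = 2 j` and `j ^ 2 +
j + 2 d j` for `g = 2 j + 1`. It vanishes only for `j = 2`, `d = 0` in the even case. -/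
lemma starCost_le_succ {n g : ℕ} (hg : 3 ≤ g) (h : g + 2 ≤ n) :
    starCost n g ≤ starCost n (g + 1) ∧
      (¬ (g = 4 ∧ n = 6) → starCost n g < starCost n (g + 1)) := by
  have h1 := starCost_succ h
  obtain ⟨d, rfl⟩ : ∃ d, n = g + 2 + d := ⟨n - (g + 2), by omega⟩
  obtain ⟨j, rfl | rfl⟩ := Nat.even_or_odd' g
  · rw [show (2 * j) ^ 2 / 4 = j ^ 2 by rw [mul_pow]; omega, show (2 * j + 1) / 2 = j by omega,
      show 2 * (2 * j + 2 + d) - (2 * j + 1) = 2 * j + 3 + 2 * d by omega,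
      show 2 * j + 2 + d - 1 = 2 * j + 1 + d by omega] at h1
    obtain ⟨i, rfl⟩ : ∃ i, j = i + 2 := ⟨j - 2, by omega⟩
    refine ⟨by nlinarith, fun hne => ?_⟩
    have : 1 ≤ i + d := by omega
    nlinarith
  · rw [show (2 * j + 1) ^ 2 / 4 = j ^ 2 + j by
        rw [show (2 * j + 1) ^ 2 = 1 + 4 * (j ^ 2 + j) by ring]; omega,
      show (2 * j + 1 + 1) / 2 = j + 1 by omega,
      show 2 * (2 * j + 1 + 2 + d) - (2 * j + 1 + 1) = 2 * j + 4 + 2 * d by omega,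
      show 2 * j + 1 + 2 + d - 1 = 2 * j + 2 + d by omega] at h1
    have : starCost (2 * j + 1 + 2 + d) (2 * j + 1) <
        starCost (2 * j + 1 + 2 + d) (2 * j + 1 + 1) := by
      have : 1 ≤ j := by omega
      nlinarith
    exact ⟨this.le, fun _ => this⟩

lemma starCost_mono {n g m : ℕ} (hg : 3 ≤ g) (h : g + m + 1 ≤ n) :
    starCost n g ≤ starCost n (g + m) := by
  induction m with
  | zero => exact le_rfl
  | succ m ih => exact (ih (by omega)).trans (starCost_le_succ (by omega) (by omega)).1

lemma starCost_lt {n g g' : ℕ} (hg : 3 ≤ g) (hgg' : g < g') (h : g' + 1 ≤ n)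
    (hne : ¬ (g = 4 ∧ n = 6)) : starCost n g < starCost n g' := by
  obtain ⟨m, rfl⟩ : ∃ m, g' = g + 1 + m := ⟨g' - (g + 1), by omega⟩
  exact ((starCost_le_succ hg (by omega)).2 hne).trans_le (starCost_mono (by omega) (by omega))

lemma sum_mul_sub_eq {n N b : ℕ} (hn : 1 ≤ n) (h : N ≤ b) :
    ∑ j ∈ range n, (n - 1 - 2 * j) * (N - b * j) = (n - 1) * N := by
  rw [sum_eq_single 0]
  · simp
  · intro j _ hj
    have : b ≤ b * j := Nat.le_mul_of_pos_right _ (by omega)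
    rw [Nat.sub_eq_zero_of_le (h.trans this), mul_zero]
  · intro h0
    exact absurd (mem_range.2 hn) h0

/-! ### Competitors. -/

section targets

variable {V : Type*} [Fintype V]

lemma exists_ring_mem_unicyclicFamily {k : ℕ} (b : ZMod (k + 3) → ℕ) (L : ℕ → ℕ)
    (hL : ∀ i, ∀ a < b i, 1 ≤ L a)
    (hcard : k + 3 + ∑ i, ∑ a ∈ range (b i), L a = Fintype.card V) :
    ∃ G ∈ unicyclicFamily V
        (∑ i, ((if Even (b i) then 1 else 0) + ∑ a ∈ range (b i), (L a - 1))),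
      ∑ u, ∑ w, G.dist u w ≤
        2 * ∑ j ∈ range (Fintype.card V), (Fintype.card V - 1 - 2 * j) *
            ∑ i, ∑ a ∈ range (b i), (L a - j) + cycleCost (Fintype.card V) (k + 3) +
          ∑ i : ZMod (k + 3), ∑ j : ZMod (k + 3),
            (∑ a ∈ range (b i), L a) * (∑ a ∈ range (b j), L a) * cycleNorm (i - j) := by
  let len : ∀ i, Fin (b i) → ℕ := fun i a => L a
  have hc : Fintype.card (RingVertex len) = Fintype.card V := by
    rw [card_ringVertex, ← hcard]
    simp only [len, Fin.sum_univ_eq_sum_range]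
  have h1 := sum_dist_spiderRing_le len hc
  obtain ⟨G, hG, hle⟩ := (ringForest len).exists_mem_unicyclicFamily hc.symm
  rw [evenDegreeCount_spiderRing len fun i a => hL i a a.2] at hG
  simp only [len, Fin.sum_univ_eq_sum_range (fun a => L a - 1)] at hG
  refine ⟨G, hG, hle.trans (h1.trans (le_of_eq ?_))⟩
  simp only [len, Fin.sum_univ_eq_sum_range (fun a => L a)]
  congr 3
  refine sum_congr rfl fun j _ => ?_
  congr 1
  exact sum_congr rfl fun i _ => Fin.sum_univ_eq_sum_range (fun a => L a - j) _

lemma sum_range_ite_lt {B q : ℕ} (h : q ≤ B) : ∑ a ∈ range B, (if a < q then 1 else 0) = q := by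
  rw [← card_filter]
  conv_rhs => rw [← card_range q]
  congr 1
  ext a
  simp only [mem_filter, mem_range]
  omega

/-- The balanced competitor: a cycle with `B` branches at one of its vertices. -/
lemma exists_balanced_mem_unicyclicFamily {k N B : ℕ} (hB : Even B) (hBN : B ≤ N)
    (hB0 : B = 0 → N = 0) (hcard : k + 3 + N = Fintype.card V) :
    ∃ G ∈ unicyclicFamily V (Fintype.card V - B), ∑ u, ∑ w, G.dist u w ≤
      2 * ∑ j ∈ range (Fintype.card V), (Fintype.card V - 1 - 2 * j) * (N - B * j) +
        cycleCost (Fintype.card V) (k + 3) := by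
  -- The legs are made as equal as possible. For `B = 0` also `N = 0`, and the conventions for
  -- division by zero do no harm.
  let L : ℕ → ℕ := fun a => N / B + if a < N % B then 1 else 0
  have hL : ∀ a < B, 1 ≤ L a := fun a ha => by
    have := Nat.div_pos hBN (show 0 < B by omega)
    simp only [L]
    omega
  have hmod : N % B ≤ B := by
    rcases Nat.eq_zero_or_pos B with h | h
    · rw [hB0 h]
      simp
    · exact (Nat.mod_lt _ h).le
  have hsum : ∑ a ∈ range B, L a = N := by
    simp only [L, sum_add_distrib, sum_range_ite_lt hmod, sum_const, card_range, smul_eq_mul]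
    exact Nat.div_add_mod N B
  have hsum' : ∀ j, ∑ a ∈ range B, (L a - j) ≤ N - B * j := by
    intro j
    by_cases hj : j ≤ N / B
    · have : ∑ a ∈ range B, (L a - j) + B * j = N := by
        have h1 : ∑ a ∈ range B, (L a - j) + ∑ _a ∈ range B, j = ∑ a ∈ range B, L a := by
          rw [← sum_add_distrib]
          refine sum_congr rfl fun a _ => Nat.sub_add_cancel (hj.trans (Nat.le_add_right _ _))
        rwa [sum_const, card_range, smul_eq_mul, hsum] at h1
      omega
    · rw [sum_eq_zero]
      · exact Nat.zero_le _
      · intro a _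
        simp only [L]
        split_ifs <;> omega
  let b : ZMod (k + 3) → ℕ := fun i => if i = 0 then B else 0
  have hb0 : b 0 = B := if_pos rfl
  have hbne : ∀ i, i ≠ 0 → b i = 0 := fun i hi => if_neg hi
  have key : ∀ f : ℕ → ℕ, ∑ i, ∑ a ∈ range (b i), f a = ∑ a ∈ range B, f a := by
    intro f
    rw [Fintype.sum_eq_single 0 fun i hi => by rw [hbne i hi]; rfl, hb0]
  obtain ⟨G, hG, hle⟩ := exists_ring_mem_unicyclicFamily (V := V) b L (fun i a ha => by
      by_cases hi : i = 0
      · subst hi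
        exact hL a (by rwa [hb0] at ha)
      · rw [hbne i hi] at ha
        omega) (by rw [key, hsum, hcard])
  refine ⟨G, ?_, hle.trans ?_⟩
  · convert hG using 1
    have hone : ∑ a ∈ range B, (L a - 1) + B = N := by
      have h1 : ∑ a ∈ range B, (L a - 1) + ∑ _a ∈ range B, 1 = ∑ a ∈ range B, L a := by
        rw [← sum_add_distrib]
        exact sum_congr rfl fun a ha => Nat.sub_add_cancel (hL a (mem_range.1 ha))
      rwa [sum_const, card_range, smul_eq_mul, mul_one, hsum] at h1
    -- Every cycle vertex carries an even number of legs, so it has even degree; the only odd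
    -- vertices are the `B` tips.
    have heven : ∀ i, (if Even (b i) then 1 else 0) = 1 := fun i => if_pos (by
      by_cases hi : i = 0
      · rwa [hi, hb0]
      · rw [hbne i hi]
        exact Even.zero)
    rw [sum_add_distrib, key]
    simp_rw [heven]
    rw [sum_const, card_univ, ZMod.card, smul_eq_mul, mul_one]
    congr 1
    omega
  · have hzero : ∑ i : ZMod (k + 3), ∑ j : ZMod (k + 3),
        (∑ a ∈ range (b i), L a) * (∑ a ∈ range (b j), L a) * cycleNorm (i - j) = 0 := by
      refine sum_eq_zero fun i _ => sum_eq_zero fun j _ => ?_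
      by_cases hi : i = 0
      · by_cases hj : j = 0
        · rw [hi, hj, sub_zero, cycleNorm_zero, mul_zero]
        · rw [hbne j hj]
          simp
      · rw [hbne i hi]
        simp
    rw [hzero, add_zero]
    refine Nat.add_le_add_right (Nat.mul_le_mul_left 2 (sum_le_sum fun j _ =>
      Nat.mul_le_mul_left _ ?_)) _
    rw [key fun a => L a - j]
    exact hsum' j

/-- By the handshake lemma the vertices of odd degree are even in number. -/
lemma even_card_sub_evenDegreeCount (G : SimpleGraph V) :
    Even (Fintype.card V - evenDegreeCount G) := by
  classical
  have h := G.even_card_odd_degree_vertices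
  have h1 := card_filter_add_card_filter_not (s := (univ : Finset V)) fun v => Even (G.degree v)
  simp_rw [Nat.not_even_iff_odd] at h1
  rw [card_univ] at h1
  have h2 : evenDegreeCount G = (univ.filter fun v => Even (G.degree v)).card := by
    rw [evenDegreeCount]
  rwa [← h1, h2, Nat.add_sub_cancel_left]

end targets

/-! ### At least three vertices of even degree. -/

namespace CycleForest

variable {V : Type*} {G : SimpleGraph V} {k : ℕ} (F : CycleForest G k) [Fintype V]

lemma base_eq_of_spread_eq_zero (h : F.spread = 0) {u v : V} (hu : F.dep u ≠ 0)
    (hv : F.dep v ≠ 0) : F.base u = F.base v := by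
  by_contra hne
  have h1 : ∀ w, F.dep w ≠ 0 → 0 < F.weight (F.base w) := fun w hw =>
    card_pos.2 ⟨w, mem_filter.2 ⟨F.mem_offCycle.2 hw, rfl⟩⟩
  have h2 := (sum_eq_zero_iff.1 (sum_eq_zero_iff.1 h (F.base u) (mem_univ _))) (F.base v)
    (mem_univ _)
  have h3 := cycleNorm_pos (sub_ne_zero.2 hne)
  have := Nat.mul_pos (Nat.mul_pos (h1 u hu) (h1 v hv)) h3
  omega

lemma exists_base_eq_zero (h : F.spread = 0) :
    ∃ F' : CycleForest G k, ∀ v, F'.dep v ≠ 0 → F'.base v = 0 := by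
  by_cases hex : ∃ v, F.dep v ≠ 0
  · obtain ⟨v, hv⟩ := hex
    refine ⟨F.rotate (F.base v), fun u hu => ?_⟩
    change F.base u - F.base v = 0
    rw [F.base_eq_of_spread_eq_zero h hu hv, sub_self]
  · push Not at hex
    exact ⟨F, fun v hv => absurd (hex v) hv⟩

lemma exists_iso_H
    (h : ∀ v l l', F.dep v ≠ 0 → F.IsLeaf l → F.IsLeaf l' → F.Below l v → F.Below l' v → l = l') :
    ∃ (b : ZMod (k + 3) → ℕ) (e : ∀ i, Fin (b i) ≃ {l // F.IsLeaf l ∧ F.base l = i}),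
      Nonempty (G ≃g H (ℓ := k + 3) fun i => spider fun a => F.dep (e i a)) := by
  classical
  refine ⟨fun i => Fintype.card {l // F.IsLeaf l ∧ F.base l = i},
    fun i => (Fintype.equivFin _).symm, ?_⟩
  obtain ⟨φ⟩ := F.nonempty_iso_spiderRing
    (fun i => (Fintype.equivFin {l // F.IsLeaf l ∧ F.base l = i}).symm) h
  exact ⟨φ.symm⟩

variable {b : ℕ}

/-- The combined lower bound. -/
lemma lower_bound (hb : F.leaves.card ≤ b) :
    2 * ∑ j ∈ range (Fintype.card V), (Fintype.card V - 1 - 2 * j) * (F.light.card - b * j) +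
      cycleCost (Fintype.card V) (k + F.heavy.card + 3) + F.heavy.card + F.spread ≤
      ∑ u, ∑ w, G.dist u w := by
  have h1 := F.le_sum_dist
  have h2 := F.sum_cutCost_height_le
  have h3 := F.le_sum_cutCost_height hb
  rw [show k + F.heavy.card + 3 = k + 3 + F.heavy.card by omega]
  omega

/-- A minimal graph attains the lower bound, or it is a pentagon with a pendant edge. -/
lemma minimal_cases (hr : 3 ≤ evenDegreeCount G)
    (hmin : ∀ G' ∈ unicyclicFamily V (evenDegreeCount G),
      ∑ u, ∑ w, G.dist u w ≤ ∑ u, ∑ w, G'.dist u w)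
    (hb : b = Fintype.card V - evenDegreeCount G) :
    F.heavy.card = 0 ∧ F.spread = 0 ∧
      ((b ≤ F.light.card ∧ ∑ v ∈ F.light, F.size v * (Fintype.card V - F.size v) ≤
        ∑ j ∈ range (Fintype.card V), (Fintype.card V - 1 - 2 * j) * (F.light.card - b * j)) ∨
      (k = 2 ∧ F.light.card = 1)) := by
  classical
  have hrn : evenDegreeCount G ≤ Fintype.card V := card_le_univ _
  have hbr : Fintype.card V - b = evenDegreeCount G := by omega
  have hbe : Even b := hb ▸ even_card_sub_evenDegreeCount G
  have hleaf : F.leaves.card ≤ b := by have := F.card_leaves_add_le; omega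
  have hlow := F.lower_bound hleaf
  have hn := F.card_light_add
  by_cases hbN : b ≤ F.light.card
  · obtain ⟨G', hG', hle⟩ := exists_balanced_mem_unicyclicFamily (V := V)
      (k := k + F.heavy.card) (N := F.light.card) hbe hbN (fun h0 => by
        rw [card_eq_zero]
        by_contra hne
        obtain ⟨v, hv⟩ := nonempty_iff_ne_empty.2 hne
        have h1 := F.mem_leaves.2 (F.isLeaf_leafBelow (F.mem_light.1 hv).1)
        have := card_pos.2 ⟨_, h1⟩
        omega) (by omega)
    rw [hbr] at hG'
    have h1 := hmin G' hG'
    refine ⟨by omega, by omega, Or.inl ⟨hbN, ?_⟩⟩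
    have h2 := F.le_sum_dist
    rw [show k + F.heavy.card + 3 = k + 3 + F.heavy.card by omega] at hle
    omega
  · have hN : 1 ≤ F.light.card := by
      refine card_pos.2 (F.light_nonempty ?_)
      rw [nonempty_iff_ne_empty]
      intro h0
      have h1 : evenDegreeCount G = Fintype.card V := by
        rw [← card_univ, evenDegreeCount]
        congr 1
        rw [filter_eq_self]
        intro v _
        have hv : F.dep v = 0 := by
          by_contra hv
          have := F.mem_offCycle.2 hv
          rw [h0] at this
          simp at this
        rw [← F.cyc_base v hv]
        exact F.even_degree_cyc (by rw [weight, h0]; rfl)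
      omega
    have hb2 : 2 ≤ b := by
      obtain ⟨c, hc⟩ := hbe
      omega
    obtain ⟨k', hk'⟩ := Nat.exists_eq_add_of_le' hr
    -- Here the competitor is a cycle of length `r` with `b` pendant edges; `b > light.card` says
    -- that `r` is less than `k + 3 + heavy.card`.
    obtain ⟨G', hG', hle⟩ := exists_balanced_mem_unicyclicFamily (V := V)
      (k := k') (N := b) hbe le_rfl id (by omega)
    rw [hbr] at hG'
    have h1 := hmin G' hG'
    rw [sum_mul_sub_eq (by omega) le_rfl] at hle
    rw [sum_mul_sub_eq (by omega) (by omega)] at hlow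
    have hs1 : 2 * ((Fintype.card V - 1) * b) + cycleCost (Fintype.card V) (k' + 3) =
        starCost (Fintype.card V) (k' + 3) := by
      rw [starCost, show Fintype.card V - (k' + 3) = b by omega]
    have hs2 : 2 * ((Fintype.card V - 1) * F.light.card) +
        cycleCost (Fintype.card V) (k + F.heavy.card + 3) =
        starCost (Fintype.card V) (k + F.heavy.card + 3) := by
      rw [starCost, show Fintype.card V - (k + F.heavy.card + 3) = F.light.card by omega]
    rw [hs1] at hle
    rw [hs2] at hlow
    by_cases hex : k' + 3 = 4 ∧ Fintype.card V = 6
    · have h46 : starCost 6 4 = starCost 6 5 := by decide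
      have hk5 : k + F.heavy.card + 3 = 5 := by omega
      rw [hex.1, hex.2] at hle
      rw [hk5, hex.2] at hlow
      exact ⟨by omega, by omega, Or.inr ⟨by omega, by omega⟩⟩
    · have := starCost_lt (n := Fintype.card V) (g := k' + 3) (g' := k + F.heavy.card + 3)
        (by omega) (by omega) (by omega) hex
      omega

/-- The graphs that attain the lower bound are balanced. -/
lemma exists_balanced_iso (hbe : Even b) (hleaf : F.leaves.card ≤ b) (hheavy : F.heavy.card = 0)
    (hbase : ∀ v, F.dep v ≠ 0 → F.base v = 0) (hbN : b ≤ F.light.card)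
    (hsum : ∑ v ∈ F.light, F.size v * (Fintype.card V - F.size v) ≤
        ∑ j ∈ range (Fintype.card V), (Fintype.card V - 1 - 2 * j) * (F.light.card - b * j)) :
    ∃ (t b₂ g : ℕ) (S : RootedGraph), Even b₂ ∧ 3 ≤ g ∧ IsSaB t b₂ S ∧
        Nonempty (G ≃g H fun i : Fin g => if (i : ℕ) = 0 then S else K₁) := by
  classical
  obtain ⟨heq, hcount⟩ := F.size_eq_height_of_sum_le hleaf hsum
  have hlight : ∀ v, F.dep v ≠ 0 → v ∈ F.light := by
    intro v hv
    rw [card_eq_zero] at hheavy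
    by_contra hnl
    have : v ∈ F.heavy := F.mem_heavy.2 ⟨hv, by
      by_contra h
      exact hnl (F.mem_light.2 ⟨hv, by omega⟩)⟩
    rw [hheavy] at this
    simp at this
  have huniq : ∀ v l, F.dep v ≠ 0 → F.IsLeaf l → F.Below l v → l = F.leafBelow v :=
    fun v l hv hl hlv => F.eq_leafBelow hv (heq v (hlight v hv)).le hl hlv
  -- Equality in each layer turns the upper bound `b * j` on the number of vertices of height at
  -- most `j` into a lower bound. For `j = 1` it yields exactly `b` leaves.
  have hlow : ∀ j, b * j ≤ F.light.card → b * j ≤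
      (F.light.filter fun v => F.height v ≤ j).card := by
    intro j hj
    have h1 := hcount j
    have h2 := card_filter_add_card_filter_not (s := F.light) fun v => F.height v ≤ j
    have h3 : (F.light.filter fun v => ¬ F.height v ≤ j) = F.light.filter fun v => j < F.height v :=
      filter_congr fun v _ => not_le
    rw [h3] at h2
    omega
  have hleq : F.leaves.card = b := by
    refine le_antisymm hleaf ?_
    have h1 := hlow 1 (by omega)
    have h2 := F.card_filter_height_le (S := F.light) (fun v hv => (F.mem_light.1 hv).1) 1
    omega
  have hdep : ∀ j, b * j < F.light.card → ∀ l, F.IsLeaf l → j ≤ F.dep l := by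
    intro j hj l hl
    by_contra hlt
    have h1 := F.card_filter_height_le_of_dep_lt (S := F.light)
      (fun v hv => (F.mem_light.1 hv).1) hl (not_le.1 hlt)
    have h2 := hlow j hj.le
    rw [hleq] at h1
    omega
  obtain ⟨c, e, ⟨φ⟩⟩ := F.exists_iso_H fun v l l' hv hl hl' h h' =>
    (huniq v l hv hl h).trans (huniq v l' hv hl' h').symm
  have hc0 : c 0 = b := by
    rw [← hleq, ← Fintype.card_fin (c 0), Fintype.card_congr (e 0), Fintype.card_subtype, leaves]
    congr 1
    ext l
    simp only [mem_filter, mem_univ, true_and]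
    exact ⟨fun h => h.1, fun h => ⟨h, hbase l h.dep_ne_zero⟩⟩
  have hcne : ∀ i, i ≠ 0 → c i = 0 := by
    intro i hi
    by_contra h
    have := (e i ⟨0, Nat.pos_of_ne_zero h⟩).2
    exact hi (this.2.symm.trans (hbase _ this.1.dep_ne_zero))
  have hsup : ∀ a, F.dep (e 0 a) ≤ univ.sup fun a => F.dep (e 0 a) :=
    fun a => le_sup (f := fun a => F.dep (e 0 a)) (mem_univ a)
  set t := univ.sup fun a => F.dep (e 0 a) with ht
  refine ⟨t, c 0, k + 3, spider fun a => F.dep (e 0 a), hc0 ▸ hbe, by omega,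
    ⟨_, rfl, ?_, ?_, ?_⟩, ?_⟩
  · intro a
    have ha := (e 0 a).2.1
    have h1 := ha.dep_ne_zero
    refine ⟨by omega, ?_⟩
    have h2 := hsup a
    obtain ⟨a', -, ha'⟩ := exists_mem_eq_sup univ ⟨a, mem_univ a⟩ fun a => F.dep (e 0 a)
    rw [← ht] at ha'
    have hl' := (e 0 a').2.1
    -- On a longest leg the vertex of depth one has height `t`, so layer `t - 1` is not empty. By
    -- `hdep` every leg then has length at least `t - 1`.
    have h3 : b * (t - 1) < F.light.card := by
      have h4 := F.dep_iterate (v := e 0 a') (j := t - 1) (by omega)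
      have h5 := F.below_iterate (u := e 0 a') (j := t - 1) (by omega)
      have h6 : F.dep (F.next^[t - 1] (e 0 a')) ≠ 0 := by omega
      have h7 := huniq _ _ h6 hl' h5
      have h8 : F.height (F.next^[t - 1] (e 0 a')) = t := by
        rw [height, ← h7]
        omega
      have h9 : 0 < (F.light.filter fun v => t - 1 < F.height v).card :=
        card_pos.2 ⟨F.next^[t - 1] (e 0 a'), mem_filter.2 ⟨hlight _ h6, by omega⟩⟩
      have h10 := hcount (t - 1)
      omega
    have h11 := hdep _ h3 _ ha
    omega
  · intro h0
    rw [ht]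
    have : IsEmpty (Fin (c 0)) := h0 ▸ Fin.isEmpty
    rw [univ_eq_empty, sup_empty]
    rfl
  · intro h0
    obtain ⟨a', -, ha'⟩ := exists_mem_eq_sup univ ⟨⟨0, h0⟩, mem_univ _⟩ fun a => F.dep (e 0 a)
    exact ⟨a', ha'.symm⟩
  · obtain ⟨ψ⟩ := H_congr (ℓ := k + 3) (T := fun i => spider fun a => F.dep (e i a))
      (T' := fun i => if (i : ℕ) = 0 then spider fun a => F.dep (e 0 a) else K₁) fun i => by
        by_cases hi : i = 0
        · subst hi
          exact RootedIso.refl _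
        · have hi' : (i : ℕ) ≠ 0 := fun h => hi (Fin.ext h)
          rw [if_neg hi']
          exact spider_rootedIso_K₁ _ (hcne i hi)
    exact ⟨φ.trans ψ⟩

include F in
lemma exists_iso_of_three_le (hr : 3 ≤ evenDegreeCount G)
    (hmin : ∀ G' ∈ unicyclicFamily V (evenDegreeCount G),
      ∑ u, ∑ w, G.dist u w ≤ ∑ u, ∑ w, G'.dist u w) :
    Nonempty (G ≃g H ![K₂, K₁, K₁, K₁, K₁]) ∨
      ∃ (t b₂ g : ℕ) (S : RootedGraph), Even b₂ ∧ 3 ≤ g ∧ IsSaB t b₂ S ∧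
        Nonempty (G ≃g H fun i : Fin g => if (i : ℕ) = 0 then S else K₁) := by
  classical
  -- Zero spread is needed first, so that the description can be rotated to put all branches at
  -- index `0`; the case analysis then runs on the rotated description.
  obtain ⟨-, hspread, -⟩ := F.minimal_cases hr hmin rfl
  obtain ⟨F', hbase⟩ := F.exists_base_eq_zero hspread
  have hleaf := F'.card_leaves_add_le
  obtain ⟨hheavy, -, ⟨hbN, hsum⟩ | ⟨rfl, hN⟩⟩ := F'.minimal_cases hr hmin rfl
  · exact Or.inr (F'.exists_balanced_iso (even_card_sub_evenDegreeCount G) (by omega) hheavy hbase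
      hbN hsum)
  · left
    have hoff : F'.offCycle.card = 1 := by rw [← F'.card_heavy_add_card_light]; omega
    obtain ⟨v, hv⟩ := card_eq_one.1 hoff
    have hv0 : ∀ u, F'.dep u ≠ 0 ↔ u = v := fun u => by
      rw [← F'.mem_offCycle, hv, mem_singleton]
    have hvl : F'.IsLeaf v := by
      obtain ⟨l, hl, -⟩ := F'.exists_isLeaf_below ((hv0 v).2 rfl)
      rwa [(hv0 l).1 hl.dep_ne_zero] at hl
    have hdv : F'.dep v = 1 := by
      have h1 := F'.dep_next v ((hv0 v).2 rfl)
      have h2 : F'.dep (F'.next v) = 0 := by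
        by_contra h2
        exact hvl v ((hv0 _).1 h2)
      omega
    obtain ⟨c, e, ⟨φ⟩⟩ := F'.exists_iso_H fun u l l' _ hl hl' _ _ =>
      ((hv0 l).1 hl.dep_ne_zero).trans ((hv0 l').1 hl'.dep_ne_zero).symm
    have hcne : ∀ i, i ≠ 0 → c i = 0 := by
      intro i hi
      by_contra h
      have := (e i ⟨0, Nat.pos_of_ne_zero h⟩).2
      exact hi (this.2.symm.trans (hbase _ this.1.dep_ne_zero))
    have hc0 : c 0 = 1 := by
      rw [← Fintype.card_fin (c 0), Fintype.card_congr (e 0), Fintype.card_eq_one_iff]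
      exact ⟨⟨v, hvl, hbase v ((hv0 v).2 rfl)⟩, fun l => Subtype.ext ((hv0 _).1 l.2.1.dep_ne_zero)⟩
    have hlen : ∀ a, F'.dep (e 0 a) = 1 := fun a => by
      rw [(hv0 _).1 (e 0 a).2.1.dep_ne_zero, hdv]
    obtain ⟨ψ⟩ := H_congr (ℓ := 5) (T := fun i => spider fun a => F'.dep (e i a))
      (T' := ![K₂, K₁, K₁, K₁, K₁]) fun i => by
        by_cases hi : i = 0
        · subst hi
          exact spider_rootedIso_K₂ _ hc0 hlen
        · have : (![K₂, K₁, K₁, K₁, K₁] : Fin 5 → RootedGraph) i = K₁ := by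
            fin_cases i
            · exact absurd rfl hi
            all_goals rfl
          rw [this]
          exact spider_rootedIso_K₁ _ (hcne i hi)
    exact ⟨φ.trans ψ⟩

end CycleForest

/-! ### At most two vertices of even degree. -/

lemma sum_zmod_three (f : ZMod (0 + 3) → ℕ) : ∑ i, f i = f 0 + f 1 + f 2 := Fin.sum_univ_three f

lemma sum_sum_mul_cycleNorm_three (w : ZMod (0 + 3) → ℕ) :
    ∑ i, ∑ j, w i * w j * cycleNorm (i - j) = 2 * (w 0 * w 1 + w 1 * w 2 + w 2 * w 0) := by
  have h : ∀ i j : ZMod (0 + 3), cycleNorm (i - j) = if i = j then 0 else 1 := by decide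
  simp_rw [h, sum_zmod_three]
  have h01 : (0 : ZMod (0 + 3)) ≠ 1 := by decide
  have h02 : (0 : ZMod (0 + 3)) ≠ 2 := by decide
  have h12 : (1 : ZMod (0 + 3)) ≠ 2 := by decide
  simp only [h01, h02, h12, h01.symm, h02.symm, h12.symm, if_true, if_false]
  ring

/-- The competitor with a triangle, for at most two vertices of even degree. -/
lemma exists_triangle_mem_unicyclicFamily {V : Type*} [Fintype V] {B x y : ℕ} (hB : Odd B)
    (hx : x ≤ 1) (hy : y ≤ 1) (hcard : 3 + (B + x + y) = Fintype.card V) :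
    ∃ G ∈ unicyclicFamily V (2 - (x + y)), ∑ u, ∑ w, G.dist u w ≤
      starCost (Fintype.card V) 3 + 2 * (B * x + x * y + y * B) := by
  let b : ZMod (0 + 3) → ℕ := ![B, x, y]
  have h0 : b 0 = B := rfl
  have h1 : b 1 = x := rfl
  have h2 : b 2 = y := rfl
  obtain ⟨G, hG, hle⟩ := exists_ring_mem_unicyclicFamily (V := V) (k := 0) b (fun _ => 1)
    (fun _ _ _ => le_rfl) (by
      rw [sum_zmod_three]
      simp only [h0, h1, h2, sum_const, card_range, smul_eq_mul, mul_one]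
      omega)
  refine ⟨G, ?_, hle.trans ?_⟩
  · convert hG using 1
    rw [sum_zmod_three]
    simp only [h0, h1, h2, Nat.sub_self, sum_const_zero, add_zero, if_neg (Nat.not_even_iff_odd.2 hB)]
    interval_cases x <;> interval_cases y <;> rfl
  · simp only [sum_const, card_range, smul_eq_mul, mul_one]
    rw [sum_sum_mul_cycleNorm_three, h0, h1, h2]
    refine Nat.add_le_add_right ?_ _
    rw [starCost]
    refine Nat.add_le_add_right (Nat.mul_le_mul_left 2 ?_) _
    rw [← sum_mul_sub_eq (n := Fintype.card V) (N := Fintype.card V - 3) (b := Fintype.card V - 3)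
      (by omega) le_rfl]
    refine sum_le_sum fun j _ => Nat.mul_le_mul_left _ ?_
    rw [sum_zmod_three]
    simp only [h0, h1, h2]
    cases j with
    | zero =>
      simp only [Nat.sub_zero, mul_one, mul_zero]
      omega
    | succ j =>
      rw [show 1 - (j + 1) = 0 by omega]
      simp

namespace CycleForest

variable {V : Type*} {G : SimpleGraph V} {k : ℕ} (F : CycleForest G k) [Fintype V]

lemma size_add_le_of_mem_offCycle {v : V} (hv : v ∈ F.offCycle) :
    F.size v + (k + 3) ≤ Fintype.card V := by
  have h1 := F.mem_offCycle.1 hv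
  have := F.size_add_dep_le h1
  omega

/-- The difference is `(s - 1) * (n - s - 1)` with `s` the size; it is zero only for `s = 1`, as the
cycle lies outside the subtree. -/
lemma le_size_mul {v : V} (hv : v ∈ F.offCycle) :
    Fintype.card V - 1 ≤ F.size v * (Fintype.card V - F.size v) := by
  have h1 := F.one_le_size v
  have h2 := F.size_add_le_of_mem_offCycle hv
  obtain ⟨s, hs⟩ := Nat.exists_eq_add_of_le' h1
  obtain ⟨d, hd⟩ := Nat.exists_eq_add_of_le h2
  rw [hs] at hd ⊢
  rw [hd, show s + 1 + (k + 3) + d - (s + 1) = k + 3 + d by omega,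
    show s + 1 + (k + 3) + d - 1 = s + (k + 3 + d) by omega]
  nlinarith

lemma lt_size_mul {v : V} (hv : v ∈ F.offCycle) (h : F.size v ≠ 1) :
    Fintype.card V - 1 < F.size v * (Fintype.card V - F.size v) := by
  have h1 := F.one_le_size v
  have h2 := F.size_add_le_of_mem_offCycle hv
  obtain ⟨s, hs⟩ := Nat.exists_eq_add_of_le' (show 2 ≤ F.size v by omega)
  obtain ⟨d, hd⟩ := Nat.exists_eq_add_of_le h2
  rw [hs] at hd ⊢
  rw [hd, show s + 2 + (k + 3) + d - (s + 2) = k + 3 + d by omega,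
    show s + 2 + (k + 3) + d - 1 = s + 1 + (k + 3 + d) by omega]
  nlinarith

lemma starCost_add_spread_le :
    starCost (Fintype.card V) (k + 3) + F.spread ≤ ∑ u, ∑ w, G.dist u w := by
  rw [F.sum_dist, starCost]
  refine Nat.add_le_add_right (Nat.add_le_add_right (Nat.mul_le_mul_left 2 ?_) _) _
  rw [show Fintype.card V - (k + 3) = F.offCycle.card by have := F.card_offCycle; omega, mul_comm,
    ← smul_eq_mul, ← sum_const]
  exact sum_le_sum fun v hv => F.le_size_mul hv

lemma size_eq_one_of_sum_le
    (h : ∑ u, ∑ w, G.dist u w ≤ starCost (Fintype.card V) (k + 3) + F.spread) :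
    ∀ v ∈ F.offCycle, F.size v = 1 := by
  by_contra! hne
  obtain ⟨v, hv, hne⟩ := hne
  have h1 : ∑ v ∈ F.offCycle, (Fintype.card V - 1) <
      ∑ v ∈ F.offCycle, F.size v * (Fintype.card V - F.size v) :=
    sum_lt_sum (fun v hv => F.le_size_mul hv) ⟨v, hv, F.lt_size_mul hv hne⟩
  rw [sum_const, smul_eq_mul, mul_comm,
    show F.offCycle.card = Fintype.card V - (k + 3) by have := F.card_offCycle; omega] at h1
  rw [F.sum_dist, starCost, cycleCost] at h
  omega

/-- For positive weights, `(w_i - 1) (w_j - 1) ≥ 0` gives `w_i w_j ≥ w_i + w_j - 1`; this is summed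
over ordered pairs of distinct indices. The correction term in `key` cancels the diagonal. -/
lemma spread_ge (h : ∀ i, F.weight i ≠ 0) :
    (k + 2) * (2 * F.offCycle.card) ≤ F.spread + (k + 2) * (k + 3) := by
  have key : ∀ i j : ZMod (k + 3), (F.weight i + F.weight j - 1 : ℤ) -
      (if i = j then 2 * F.weight i - 1 else 0 : ℤ) ≤
      (F.weight i * F.weight j * cycleNorm (i - j) : ℕ) := by
    intro i j
    split_ifs with hij
    · subst hij
      rw [sub_self, cycleNorm_zero, mul_zero]
      push_cast
      linarith
    · have h1 := cycleNorm_pos (sub_ne_zero.2 hij)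
      have h2 : F.weight i * F.weight j * 1 ≤ F.weight i * F.weight j * cycleNorm (i - j) :=
        Nat.mul_le_mul_left _ h1
      have h3 : 1 ≤ F.weight i := Nat.pos_of_ne_zero (h i)
      have h4 : 1 ≤ F.weight j := Nat.pos_of_ne_zero (h j)
      zify at h2 h3 h4 ⊢
      nlinarith [mul_nonneg (sub_nonneg.2 h3) (sub_nonneg.2 h4)]
  have hsum := sum_le_sum fun i (_ : i ∈ univ) => sum_le_sum fun j (_ : j ∈ univ) => key i j
  have hw : ∑ i, (F.weight i : ℤ) = F.offCycle.card := by
    exact_mod_cast F.sum_weight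
  simp only [sum_sub_distrib, sum_add_distrib, sum_const, card_univ, ZMod.card, nsmul_eq_mul,
    sum_ite_eq, mem_univ, if_true, ← mul_sum, hw, mul_one] at hsum
  have h5 : (F.spread : ℤ) = ∑ i : ZMod (k + 3), ∑ j : ZMod (k + 3),
      ((F.weight i * F.weight j * cycleNorm (i - j) : ℕ) : ℤ) := by
    rw [spread]
    push_cast
    rfl
  rw [← h5] at hsum
  zify
  push_cast at hsum
  nlinarith

lemma spread_pos {i j : ZMod (k + 3)} (hij : i ≠ j) (hi : F.weight i ≠ 0) (hj : F.weight j ≠ 0) :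
    F.spread ≠ 0 := by
  intro h
  obtain ⟨u, hu⟩ := card_pos.1 (Nat.pos_of_ne_zero hi)
  obtain ⟨v, hv⟩ := card_pos.1 (Nat.pos_of_ne_zero hj)
  rw [mem_filter, mem_offCycle] at hu hv
  exact hij (hu.2 ▸ hv.2 ▸ F.base_eq_of_spread_eq_zero h hu.1 hv.1)

lemma weight_rotate (i₀ i : ZMod (k + 3)) : (F.rotate i₀).weight i = F.weight (i + i₀) := by
  classical
  unfold weight
  congr 1
  ext v
  rw [mem_filter, mem_filter, mem_offCycle, mem_offCycle]
  exact and_congr_right fun _ => sub_eq_iff_eq_add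

/-- If all subtrees are single vertices, then the graph is a triangle with pendant edges. -/
lemma exists_triangle_iso (F : CycleForest G 0) (hsize : ∀ v ∈ F.offCycle, F.size v = 1)
    (h1 : F.weight 1 ≤ 1) (h2 : F.weight 2 ≤ 1) :
    ∃ X₁ X₂ : RootedGraph, (X₁ = K₁ ∨ X₁ = K₂) ∧ (X₂ = K₁ ∨ X₂ = K₂) ∧
      Nonempty (G ≃g H ![SB 1 (F.weight 0), X₁, X₂]) := by
  classical
  have hleaf : ∀ v, F.dep v ≠ 0 → F.IsLeaf v := by
    intro v hv u hu
    have hu0 : F.dep u ≠ 0 := fun h => hv (hu ▸ F.dep_next_of_eq_zero h)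
    have h3 := F.size_lt_size_next hu0
    rw [hu, hsize v (F.mem_offCycle.2 hv)] at h3
    have := F.one_le_size u
    omega
  have hdep : ∀ v, F.dep v ≠ 0 → F.dep v = 1 := by
    intro v hv
    by_contra h
    have h3 := F.dep_next v hv
    exact hleaf (F.next v) (by omega) v rfl
  obtain ⟨b, e, ⟨φ⟩⟩ := F.exists_iso_H fun v l l' hv _ _ h h' =>
    ((hleaf v hv).eq_of_below h).trans ((hleaf v hv).eq_of_below h').symm
  have hb : ∀ i, b i = F.weight i := by
    intro i
    rw [← Fintype.card_fin (b i), Fintype.card_congr (e i), Fintype.card_subtype, weight]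
    congr 1
    ext v
    simp only [mem_filter, mem_univ, true_and, mem_offCycle]
    exact and_congr_left fun _ => ⟨fun h => h.dep_ne_zero, hleaf v⟩
  have hlen : ∀ i a, F.dep (e i a) = 1 := fun i a => hdep _ (e i a).2.1.dep_ne_zero
  have hX : ∀ i, F.weight i ≤ 1 → ∃ X, (X = K₁ ∨ X = K₂) ∧
      RootedIso (spider fun a => F.dep (e i a)) X := by
    intro i hi
    rcases Nat.le_one_iff_eq_zero_or_eq_one.1 hi with h | h
    · exact ⟨K₁, Or.inl rfl, spider_rootedIso_K₁ _ ((hb i).trans h)⟩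
    · exact ⟨K₂, Or.inr rfl, spider_rootedIso_K₂ _ ((hb i).trans h) (hlen i)⟩
  obtain ⟨X₁, hX₁, hi₁⟩ := hX 1 h1
  obtain ⟨X₂, hX₂, hi₂⟩ := hX 2 h2
  have h0 : RootedIso (spider fun a => F.dep (e 0 a)) (SB 1 (F.weight 0)) := by
    rw [← hb 0, SB, show (fun a => F.dep (e 0 a)) = fun _ => 1 from funext (hlen 0)]
    exact RootedIso.refl _
  obtain ⟨ψ⟩ := H_congr (ℓ := 3) (T := fun i => spider fun a => F.dep (e i a))
    (T' := ![SB 1 (F.weight 0), X₁, X₂]) (by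
      intro i
      fin_cases i
      · exact h0
      · exact hi₁
      · exact hi₂)
  exact ⟨X₁, X₂, hX₁, hX₂, ⟨φ.trans ψ⟩⟩

omit [Fintype V] in
/-- The possible triples of weights on a triangle. -/
lemma exists_shift_of_le {w : ZMod (0 + 3) → ℕ} {r : ℕ} (hr : r ≤ 2)
    (hz : (univ.filter fun i => w i = 0).card ≤ r)
    (hle : 2 * (w 0 * w 1 + w 1 * w 2 + w 2 * w 0) ≤
      2 * ((w 0 + w 1 + w 2 - (2 - r)) * (2 - r) + (1 - r))) :
    (∃ i₀, w (1 + i₀) + w (2 + i₀) = 2 - r ∧ w (1 + i₀) ≤ 1 ∧ w (2 + i₀) ≤ 1 ∧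
      w (0 + i₀) + w (1 + i₀) + w (2 + i₀) = w 0 + w 1 + w 2) ∧
      2 * ((w 0 + w 1 + w 2 - (2 - r)) * (2 - r) + (1 - r)) ≤
        2 * (w 0 * w 1 + w 1 * w 2 + w 2 * w 0) := by
  rw [card_filter, sum_zmod_three] at hz
  suffices h : ((w 1 + w 2 = 2 - r ∧ w 1 ≤ 1 ∧ w 2 ≤ 1) ∨ (w 2 + w 0 = 2 - r ∧ w 2 ≤ 1 ∧ w 0 ≤ 1) ∨
      (w 0 + w 1 = 2 - r ∧ w 0 ≤ 1 ∧ w 1 ≤ 1)) ∧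
      2 * ((w 0 + w 1 + w 2 - (2 - r)) * (2 - r) + (1 - r)) ≤
        2 * (w 0 * w 1 + w 1 * w 2 + w 2 * w 0) by
    refine ⟨?_, h.2⟩
    rcases h.1 with h | h | h
    · exact ⟨0, h.1, h.2.1, h.2.2, rfl⟩
    · exact ⟨1, h.1, h.2.1, h.2.2, show w 1 + w 2 + w 0 = _ by omega⟩
    · exact ⟨2, h.1, h.2.1, h.2.2, show w 2 + w 0 + w 1 = _ by omega⟩
  generalize w 0 = a at *
  generalize w 1 = b at *
  generalize w 2 = c at *
  have h0 : r = 0 ∨ r = 1 ∨ r = 2 := by omega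
  rcases h0 with rfl | rfl | rfl
  -- All weights are positive. In terms of the excesses over one, the hypothesis says that `x y + y
  -- z + z x` vanishes, so at most one weight exceeds one.
  · have ha : a ≠ 0 := by rintro rfl; simp at hz
    have hb : b ≠ 0 := by rintro rfl; simp at hz
    have hc : c ≠ 0 := by rintro rfl; simp at hz
    obtain ⟨x, rfl⟩ := Nat.exists_eq_succ_of_ne_zero ha
    obtain ⟨y, rfl⟩ := Nat.exists_eq_succ_of_ne_zero hb
    obtain ⟨z, rfl⟩ := Nat.exists_eq_succ_of_ne_zero hc
    simp only [Nat.succ_eq_add_one] at *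
    rw [show x + 1 + (y + 1) + (z + 1) - (2 - 0) = x + y + z + 1 by omega] at *
    have h1 : x * y + y * z + z * x = 0 := by nlinarith
    have hxy : x * y = 0 := by omega
    have hyz : y * z = 0 := by omega
    have hzx : z * x = 0 := by omega
    refine ⟨?_, by nlinarith⟩
    rcases Nat.mul_eq_zero.1 hxy with rfl | rfl
    · rcases Nat.mul_eq_zero.1 hyz with rfl | rfl <;> simp
    · rcases Nat.mul_eq_zero.1 hzx with rfl | rfl <;> simp
  -- At most one weight is zero. If one is, the bound reads `(p - 1) (q - 1) ≤ 0` for the other two;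
  -- if none is, it fails.
  · have key : ∀ p q : ℕ, p ≠ 0 → q ≠ 0 → p * q ≤ p + q - 1 →
        (p = 1 ∨ q = 1) ∧ p * q = p + q - 1 := by
      intro p q hp hq h
      obtain ⟨x, rfl⟩ := Nat.exists_eq_succ_of_ne_zero hp
      obtain ⟨y, rfl⟩ := Nat.exists_eq_succ_of_ne_zero hq
      simp only [Nat.succ_eq_add_one] at *
      have h1 : (x + 1) * (y + 1) = x * y + x + y + 1 := by ring
      rw [h1] at h ⊢
      have h2 : x * y = 0 := by omega
      rcases Nat.mul_eq_zero.1 h2 with rfl | rfl <;> omega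
    norm_num at hle ⊢
    by_cases ha : a = 0
    · subst ha
      have hb : b ≠ 0 := by rintro rfl; simp at hz; omega
      have hc : c ≠ 0 := by rintro rfl; simp at hz
      have := key b c hb hc (by simpa using hle)
      simp only [zero_mul, mul_zero]
      omega
    · by_cases hb : b = 0
      · subst hb
        have hc : c ≠ 0 := by rintro rfl; simp [ha] at hz
        have := key c a hc ha (by simpa [add_comm] using hle)
        simp only [zero_mul, mul_zero]
        omega
      · by_cases hc : c = 0
        · subst hc
          have := key a b ha hb (by simpa using hle)
          simp only [zero_mul, mul_zero]
          omega
        · exfalso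
          obtain ⟨x, rfl⟩ := Nat.exists_eq_succ_of_ne_zero ha
          obtain ⟨y, rfl⟩ := Nat.exists_eq_succ_of_ne_zero hb
          obtain ⟨z, rfl⟩ := Nat.exists_eq_succ_of_ne_zero hc
          simp only [Nat.succ_eq_add_one] at *
          rw [show x + 1 + (y + 1) + (z + 1) - 1 = x + y + z + 2 by omega] at hle
          nlinarith
  · norm_num at hle ⊢
    obtain ⟨⟨h1, h2⟩, h3⟩ := hle
    omega

include F in
lemma exists_iso_of_le_two {r n : ℕ} (hr' : evenDegreeCount G = r) (hr : r ≤ 2)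
    (hn' : Fintype.card V = n)
    (hmin : ∀ G' ∈ unicyclicFamily V r, ∑ u, ∑ w, G.dist u w ≤ ∑ u, ∑ w, G'.dist u w) :
    ∃ (b₁ : ℕ) (X₁ X₂ : RootedGraph), Odd b₁ ∧ (X₁ = K₁ ∨ X₁ = K₂) ∧ (X₂ = K₁ ∨ X₂ = K₂) ∧
      Nonempty (G ≃g H ![SB 1 b₁, X₁, X₂]) := by
  classical
  have hn := F.card_offCycle
  rw [hn'] at hn
  have hz := F.card_weight_eq_zero_le
  rw [hr'] at hz
  have hnz := card_filter_add_card_filter_not (s := univ) fun i => F.weight i = 0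
  rw [card_univ, ZMod.card] at hnz
  have hpos : k + 3 - r ≤ F.offCycle.card := by
    have h2 : (univ.filter fun i => ¬ F.weight i = 0).card ≤ F.offCycle.card := by
      rw [← F.sum_weight, card_filter]
      exact sum_le_sum fun i _ => by split_ifs <;> omega
    omega
  have hpar := even_card_sub_evenDegreeCount G
  rw [hr', hn'] at hpar
  have hB : Odd (n + r - 5) := by
    rw [Nat.even_iff] at hpar
    rw [Nat.odd_iff]
    omega
  -- In truncated subtraction, `(x, y)` is `(1, 1)`, `(1, 0)`, `(0, 0)` for `r = 0, 1, 2`, so that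
  -- exactly `r` triangle vertices are bare; `B` is what remains.
  obtain ⟨G', hG', hle⟩ := exists_triangle_mem_unicyclicFamily (V := V) (B := n + r - 5)
    (x := 2 - r - (1 - r)) (y := 1 - r) hB (by omega) (by omega) (by omega)
  rw [show 2 - (2 - r - (1 - r) + (1 - r)) = r by omega] at hG'
  have hQ : (n + r - 5) * (2 - r - (1 - r)) + (2 - r - (1 - r)) * (1 - r) + (1 - r) * (n + r - 5) =
      (n + r - 5) * (2 - r) + (1 - r) := by
    have : r = 0 ∨ r = 1 ∨ r = 2 := by omega
    rcases this with h | h | h <;> rw [h] <;> ring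
  rw [hQ, hn'] at hle
  have hup := (hmin G' hG').trans hle
  have hlow := F.starCost_add_spread_le
  rw [hn'] at hlow
  have hk : k = 0 := by
    by_contra hk
    obtain ⟨k, rfl⟩ := Nat.exists_eq_succ_of_ne_zero hk
    -- From length 3 to length 4 `starCost` grows by `2 n - 8`. This leaves for the spread at most
    -- `2 n - 10` if `r = 0` and zero if `r = 1`; for `r = 2` the bounds already contradict each
    -- other.
    have h4 : starCost n 4 ≤ starCost n (4 + k) := starCost_mono (by norm_num) (by omega)
    have h3 := starCost_succ (n := n) (g := 3) (by omega)
    norm_num at h3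
    rw [show k.succ + 3 = 4 + k by omega] at hlow
    have : r = 0 ∨ r = 1 ∨ r = 2 := by omega
    rcases this with rfl | rfl | rfl
    · have h5 : ∀ i, F.weight i ≠ 0 := by
        intro i hi
        have : 0 < (univ.filter fun i => F.weight i = 0).card :=
          card_pos.2 ⟨i, mem_filter.2 ⟨mem_univ i, hi⟩⟩
        omega
      have h6 := F.spread_ge h5
      have h7 : F.spread + 10 ≤ 2 * n := by omega
      obtain ⟨d, hd⟩ := Nat.exists_eq_add_of_le (show k.succ + 3 ≤ F.offCycle.card by omega)
      rw [hd] at hn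
      rw [hd] at h6
      rw [← hn] at h7
      simp only [Nat.succ_eq_add_one] at h6 h7
      nlinarith
    · have h6 : 1 < (univ.filter fun i => ¬ F.weight i = 0).card := by omega
      obtain ⟨i, hi, j, hj, hij⟩ := one_lt_card.1 h6
      rw [mem_filter] at hi hj
      exact F.spread_pos hij hi.2 hj.2 (by omega)
    · omega
  subst hk
  have hsw := F.sum_weight
  rw [sum_zmod_three] at hsw
  have hspread : F.spread = _ := sum_sum_mul_cycleNorm_three F.weight
  have hA : n + r - 5 = F.weight 0 + F.weight 1 + F.weight 2 - (2 - r) := by omega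
  have h03 : starCost n (0 + 3) = starCost n 3 := rfl
  rw [h03] at hlow
  rw [hA] at hup
  obtain ⟨⟨i₀, hs⟩, hge⟩ := exists_shift_of_le (w := F.weight) (r := r) hr hz (by
    rw [← hspread]
    exact Nat.le_of_add_le_add_left (hlow.trans hup))
  have hone := F.size_eq_one_of_sum_le (by
    rw [hspread, hn']
    exact hup.trans (Nat.add_le_add_left hge _))
  have hw := F.weight_rotate i₀
  obtain ⟨X₁, X₂, hX₁, hX₂, hiso⟩ := (F.rotate i₀).exists_triangle_iso
    (fun v hv => hone v hv) (by rw [hw]; exact hs.2.1) (by rw [hw]; exact hs.2.2.1)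
  refine ⟨_, X₁, X₂, ?_, hX₁, hX₂, hiso⟩
  rw [hw]
  have : F.weight (0 + i₀) = n + r - 5 := by omega
  rwa [this]

end CycleForest

end Wiener

theorem theorem1 {V : Type*} [Fintype V] (n r : ℕ) (hn : Fintype.card V = n)
    (G : SimpleGraph V) (hG : G ∈ Wiener.unicyclicFamily V r)
    (hmin : ∀ G' ∈ Wiener.unicyclicFamily V r, Wiener.wienerIndex G ≤ Wiener.wienerIndex G') :
    (r ≤ 2 → ∃ (b₁ : ℕ) (X₁ X₂ : Wiener.RootedGraph), Odd b₁ ∧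
      (X₁ = Wiener.K₁ ∨ X₁ = Wiener.K₂) ∧ (X₂ = Wiener.K₁ ∨ X₂ = Wiener.K₂) ∧
      Nonempty (G ≃g Wiener.H ![Wiener.SB 1 b₁, X₁, X₂])) ∧
    (3 ≤ r →
      Nonempty (G ≃g Wiener.H ![Wiener.K₂, Wiener.K₁, Wiener.K₁, Wiener.K₁, Wiener.K₁]) ∨
      ∃ (t b₂ g : ℕ) (S : Wiener.RootedGraph), Even b₂ ∧ 3 ≤ g ∧ Wiener.IsSaB t b₂ S ∧
        Nonempty (G ≃g Wiener.H fun i : Fin g => if (i : ℕ) = 0 then S else Wiener.K₁)) := by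
  obtain ⟨hU, rfl⟩ := hG
  obtain ⟨k, ⟨F⟩⟩ := hU.exists_cycleForest
  have hmin' : ∀ G' ∈ Wiener.unicyclicFamily V (Wiener.evenDegreeCount G),
      ∑ u, ∑ w, G.dist u w ≤ ∑ u, ∑ w, G'.dist u w := by
    intro G' hG'
    have h := hmin G' hG'
    rw [Wiener.wienerIndex_eq, Wiener.wienerIndex_eq, div_le_div_iff_of_pos_right (by norm_num)] at h
    exact_mod_cast h
  exact ⟨fun hr => F.exists_iso_of_le_two rfl hr rfl hmin', fun hr => F.exists_iso_of_three_le hr hmin'⟩
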